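/- For an open set $G\subset\mathbb R^d$ let $W^{2,2}(G)$ be the second-order $L^2$-Sobolev space, and for measurable $S\subset G$ put $\|\psi\|_S^2=\int_S|\psi|^2$. Let $B(x,r)$ be the open ball. There are an absolute constant $K_\Delta\in(0,\infty)$ and, for every $d$, constants $C_2,C_3\in[1,\infty)$ depending only on the dimension $d$, with the following property. Let $K_V,D_0,R,\beta\in[0,\infty)$ and $\delta\in(0,1]$ with $\delta<4R$. There exists a constant $C_{qUC}=C_{qUC}(d,K_V,D_0,R,\delta,\beta)>0$ such that, for any open $G\subset\mathbb R^d$, any $x\in G$, any measurable $\Theta\subset G$ with $$\operatorname{diam}\Theta\le R=\operatorname{dist}(x,\Theta)\quad\text{and}\quad B(x,12R+2D_0)\subset G,$$ any measurable $V\colon G\to[-K_V,K_V]$ and any real-valued $\psi\in W^{2,2}(G)$ satisfying $$|\Delta\psi|\le|V\psi|\ \text{ a.e. on } G\quad\text{and}\quad \frac{\|\psi\|_G^2}{\|\psi\|_\Theta^2}\le\beta,$$ we have $$\|\psi\|^2_{B(x,\delta)}\ge C_{qUC}\,\|\psi\|^2_\Theta .$$ Moreover, if $D_0>0$, this constant can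 be chosen such that $$C_{qUC}\ \ge\ \frac{5}{16}\,\frac1{41}\,\frac{C_2^3}{C_3K_\Delta^4}\,\frac{\delta^4}{R^2}\left(\frac{\delta}{48R}\right)^{2\alpha}\frac1{1+K_V^2}$$ for every $\alpha$ with $$\alpha\ge C_2,\qquad \alpha\ge\left(24^5C_3K_V^2R^4\right)^{1/3},\qquad 2\alpha\ge\ln\!\left(\left(\frac{24RK_\Delta}{D}\right)^4C_3\,\frac{1+K_V^2}{D_1^2}\,\beta\right),$$ where $D=\min(D_0,12R)$ and $D_1=\min(D,1)$ (so $D=D_0$ whenever $D_0\le 12R$). -/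

import Mathlib

open MeasureTheory
open scoped ContDiff

/-- `v` is a weak partial derivative of `u` in the `i`-th coordinate direction on the open set
`G ⊆ ℝᵈ`, tested against all smooth functions with compact support in `G`. -/
def IsWeakPartial {d : ℕ} (G : Set (EuclideanSpace ℝ (Fin d))) (i : Fin d)
    (u v : EuclideanSpace ℝ (Fin d) → ℝ) : Prop :=
  LocallyIntegrableOn u G ∧ LocallyIntegrableOn v G ∧
    ∀ φ : EuclideanSpace ℝ (Fin d) → ℝ, ContDiff ℝ ∞ φ → HasCompactSupport φ → tsupport φ ⊆ G →
      ∫ y in G, u y * fderiv ℝ φ y (EuclideanSpace.single i 1) = - ∫ y in G, v y * φ y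

/-- Membership in the Sobolev space `W^{k,2}(G)` of real-valued functions on the open set `G`. -/
def MemSobolevTwo {d : ℕ} (G : Set (EuclideanSpace ℝ (Fin d))) :
    ℕ → (EuclideanSpace ℝ (Fin d) → ℝ) → Prop
  | 0, u => MemLp u 2 (volume.restrict G)
  | k + 1, u => MemLp u 2 (volume.restrict G) ∧
      ∀ i : Fin d, ∃ v, IsWeakPartial G i u v ∧ MemSobolevTwo G k v

open Classical in
/-- The weak partial derivative of `u` on `G` (unique almost everywhere on `G` where it exists;
zero if there is none). -/
noncomputable def weakPartial {d : ℕ} (G : Set (EuclideanSpace ℝ (Fin d))) (i : Fin d)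
    (u : EuclideanSpace ℝ (Fin d) → ℝ) : EuclideanSpace ℝ (Fin d) → ℝ :=
  if h : ∃ v, IsWeakPartial G i u v then h.choose else 0

/-- The weak Laplacian `∑ᵢ ∂ᵢ∂ᵢ u` on `G`. -/
noncomputable def weakLaplacian {d : ℕ} (G : Set (EuclideanSpace ℝ (Fin d)))
    (u : EuclideanSpace ℝ (Fin d) → ℝ) (y : EuclideanSpace ℝ (Fin d)) : ℝ :=
  ∑ i : Fin d, weakPartial G i (weakPartial G i u) y

/-- The squared norm `‖u‖²_S = ∫_S u²`. -/
noncomputable def sqNorm {d : ℕ} (S : Set (EuclideanSpace ℝ (Fin d)))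
    (u : EuclideanSpace ℝ (Fin d) → ℝ) : ℝ :=
  ∫ y in S, u y ^ 2

/-- The lower bounds required of the exponent `α`. -/
def AdmissibleExponent (C₂ C₃ KΔ KV D R β α : ℝ) : Prop :=
  C₂ ≤ α ∧
    (24 ^ 5 * C₃ * KV ^ 2 * R ^ 4) ^ (1 / 3 : ℝ) ≤ α ∧
    Real.log ((24 * R * KΔ / D) ^ 4 * C₃ * ((1 + KV ^ 2) / min D 1 ^ 2) * β) ≤ 2 * α

/-- The explicit lower bound for the constant, as a function of the exponent `α`. -/
noncomputable def explicitBound (C₂ C₃ KΔ KV R δ α : ℝ) : ℝ :=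
  5 / 16 * (1 / 41) * (C₂ ^ 3 / (C₃ * KΔ ^ 4)) * (δ ^ 4 / R ^ 2) *
    (δ / (48 * R)) ^ (2 * α) * (1 / (1 + KV ^ 2))

/-! The engine is a Carleman estimate with weight `w ^ (-2α)`, where `w(s) = s * exp (-s / ρ)`, `s`
is the distance to `x` and `ρ = 24 R`. The weight blows up at `x` and decreases outwards. Cut `ψ`
off to an annulus around `x`. The mass on `Θ`, which lies at distances between `R` and `2R`, is then
bounded by two cutoff errors: one near `x`, carrying the weight at `δ/5`, and one far out, carrying
the weight at `9R`. The far weight is smaller than the weight at `2R` by a factor `exp (-2α)`, so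
once `exp (2α)` dominates a multiple of `β` the far error is absorbed. What remains bounds the mass
on `Θ` by the mass near `x`, and the ratio of the weights at `2R` and `δ/5` produces `(δ / (48 R)) ^
(2α)`.

For the Carleman estimate put `t = log r`. The measure `r ^ (-d) dy` becomes `dt dω`, the Euler
derivative becomes `∂ₜ`, and `r² Δ` conjugated by the weight becomes `(∂ₜ + a)² + Δ_S - c` with `a =
α - σ r`. Write this as `S + A` with `S` symmetric and `A` skew. Then `‖(S + A) g‖² ≥ 2 ⟨S g, A g⟩`,
and integration by parts (`integral_symmPart_mul_skewPart`) turns the right side into a form bounded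
below because `a` decreases in `r` and stays at least `α / 2` on the support. This gives
`carleman_estimate`, with gain of order `α³ / ρ`.

A Caccioppoli inequality removes the gradients from the cutoff errors. The resulting estimate
`carleman_estimate_cutoff` involves only `u` and `Δu`, so it passes by mollification to functions
with a distributional Laplacian in `L²` (`weak_of_smooth_inequality`). In
`carleman_differential_inequality` the gain `α³` absorbs the potential, and
`explicitBound_of_carleman` does the final bookkeeping. -/

/-- The `i`-th partial derivative. -/
noncomputable def pd {d : ℕ} (i : Fin d) (f : EuclideanSpace ℝ (Fin d) → ℝ)
    (y : EuclideanSpace ℝ (Fin d)) : ℝ :=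
  fderiv ℝ f y (EuclideanSpace.single i 1)

/-- The classical Laplacian in coordinates. -/
noncomputable def lap {d : ℕ} (f : EuclideanSpace ℝ (Fin d) → ℝ)
    (y : EuclideanSpace ℝ (Fin d)) : ℝ :=
  ∑ i, pd i (pd i f) y

/-- The Euler (radial) derivative `y · ∇f`. -/
noncomputable def eul {d : ℕ} (f : EuclideanSpace ℝ (Fin d) → ℝ)
    (y : EuclideanSpace ℝ (Fin d)) : ℝ :=
  fderiv ℝ f y y

/-! ### Coordinate calculus for partial derivatives, the Laplacian and radial functions. -/

section Calculus

variable {d : ℕ} {f g : EuclideanSpace ℝ (Fin d) → ℝ} {y : EuclideanSpace ℝ (Fin d)}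

lemma sum_smul_single (y : EuclideanSpace ℝ (Fin d)) :
    ∑ i, y i • EuclideanSpace.single i (1 : ℝ) = y := by
  ext j
  simp [Finset.sum_apply, Pi.single_apply]

lemma eul_eq_sum (f : EuclideanSpace ℝ (Fin d) → ℝ) (y : EuclideanSpace ℝ (Fin d)) :
    eul f y = ∑ i, y i * pd i f y := by
  unfold eul pd
  conv_lhs => rw [show fderiv ℝ f y y = fderiv ℝ f y
    (∑ i, y i • EuclideanSpace.single i (1 : ℝ)) by rw [sum_smul_single]]
  simp

lemma sum_sq_eq_norm_sq (y : EuclideanSpace ℝ (Fin d)) : ∑ i, y i * y i = ‖y‖ ^ 2 := by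
  rw [EuclideanSpace.real_norm_sq_eq]
  exact Finset.sum_congr rfl fun i _ => by ring

lemma pd_mul (i : Fin d) (hf : DifferentiableAt ℝ f y) (hg : DifferentiableAt ℝ g y) :
    pd i (fun z => f z * g z) y = pd i f y * g y + f y * pd i g y := by
  unfold pd
  rw [fderiv_fun_mul hf hg]
  simp
  ring

lemma pd_add (i : Fin d) (hf : DifferentiableAt ℝ f y) (hg : DifferentiableAt ℝ g y) :
    pd i (fun z => f z + g z) y = pd i f y + pd i g y := by
  unfold pd
  rw [fderiv_fun_add hf hg]
  simp

lemma pd_sub (i : Fin d) (hf : DifferentiableAt ℝ f y) (hg : DifferentiableAt ℝ g y) :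
    pd i (fun z => f z - g z) y = pd i f y - pd i g y := by
  unfold pd
  rw [fderiv_fun_sub hf hg]
  simp

lemma pd_sum {ι : Type*} (s : Finset ι) {F : ι → EuclideanSpace ℝ (Fin d) → ℝ} (i : Fin d)
    (hF : ∀ j ∈ s, DifferentiableAt ℝ (F j) y) :
    pd i (fun z => ∑ j ∈ s, F j z) y = ∑ j ∈ s, pd i (F j) y := by
  unfold pd
  rw [fderiv_fun_sum hF]
  simp

lemma pd_congr (i : Fin d) (h : f =ᶠ[nhds y] g) : pd i f y = pd i g y := by
  unfold pd
  rw [h.fderiv_eq]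

lemma pd_coord (i j : Fin d) :
    pd i (fun z : EuclideanSpace ℝ (Fin d) => z j) y = if i = j then 1 else 0 := by
  unfold pd
  have h : fderiv ℝ (fun z : EuclideanSpace ℝ (Fin d) => z j) y = EuclideanSpace.proj j :=
    (EuclideanSpace.proj (𝕜 := ℝ) j).hasFDerivAt.fderiv
  rw [h]
  simp [eq_comm]

lemma differentiableAt_coord (j : Fin d) :
    DifferentiableAt ℝ (fun z : EuclideanSpace ℝ (Fin d) => z j) y :=
  (EuclideanSpace.proj (𝕜 := ℝ) j).differentiableAt

lemma contDiff_coord (j : Fin d) :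
    ContDiff ℝ ∞ (fun z : EuclideanSpace ℝ (Fin d) => z j) :=
  (EuclideanSpace.proj (𝕜 := ℝ) j).contDiff

lemma pd_radial (i : Fin d) {A : ℝ → ℝ} {A' : ℝ} (hy : y ≠ 0) (hA : HasDerivAt A A' ‖y‖) :
    pd i (fun z => A ‖z‖) y = A' * (y i / ‖y‖) := by
  have h := hA.comp_hasFDerivAt y ((contDiffAt_norm ℝ hy (n := 1)).differentiableAt
    (by norm_num)).hasFDerivAt
  have h' : fderiv ℝ (fun z : EuclideanSpace ℝ (Fin d) => A ‖z‖) y = _ := h.fderiv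
  unfold pd
  rw [h']
  have h2 : fderiv ℝ (fun x : EuclideanSpace ℝ (Fin d) => ‖x‖) y (EuclideanSpace.single i 1)
      = y i / ‖y‖ := by
    have h3 := (hasStrictFDerivAt_norm_sq y).hasFDerivAt
    have h4 := ((contDiffAt_norm ℝ hy (n := 1)).differentiableAt (by norm_num)).hasFDerivAt.pow 2
    have h5 := congrArg (fun L => L (EuclideanSpace.single i (1 : ℝ))) (h4.unique h3)
    have hn : ‖y‖ ≠ 0 := norm_ne_zero_iff.2 hy
    simp [EuclideanSpace.inner_single_right] at h5
    field_simp
    linarith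
  simp [h2]

lemma differentiableAt_radial {A : ℝ → ℝ} (hy : y ≠ 0) (hA : DifferentiableAt ℝ A ‖y‖) :
    DifferentiableAt ℝ (fun z : EuclideanSpace ℝ (Fin d) => A ‖z‖) y :=
  hA.comp y ((contDiffAt_norm ℝ hy (n := 1)).differentiableAt (by norm_num))

lemma ContDiffAt.pd (i : Fin d) (h : ContDiffAt ℝ ∞ f y) : ContDiffAt ℝ ∞ (pd i f) y :=
  (h.fderiv_right (m := ∞) (by simp)).clm_apply contDiffAt_const

lemma ContDiff.pd (i : Fin d) (h : ContDiff ℝ ∞ f) : ContDiff ℝ ∞ (pd i f) :=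
  contDiff_iff_contDiffAt.2 fun _ => h.contDiffAt.pd i

lemma ContDiff.lap (h : ContDiff ℝ ∞ f) : ContDiff ℝ ∞ (lap f) :=
  ContDiff.sum fun i _ => (h.pd i).pd i

lemma ContDiffAt.eul (h : ContDiffAt ℝ ∞ f y) : ContDiffAt ℝ ∞ (eul f) y :=
  (h.fderiv_right (m := ∞) (by simp)).clm_apply contDiffAt_id

lemma HasCompactSupport.pd (i : Fin d) (h : HasCompactSupport f) : HasCompactSupport (pd i f) :=
  h.fderiv_apply (𝕜 := ℝ) _

lemma pd_comm (i j : Fin d) (h : ContDiffAt ℝ ∞ f y) : pd i (pd j f) y = pd j (pd i f) y := by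
  have hd : DifferentiableAt ℝ (fderiv ℝ f) y :=
    (h.fderiv_right (m := ∞) (by simp)).differentiableAt (by simp)
  have hs := h.isSymmSndFDerivAt
    (by simpa using (WithTop.coe_le_coe.2 le_top : ((2 : ℕ∞) : WithTop ℕ∞) ≤ ∞))
    (EuclideanSpace.single i 1) (EuclideanSpace.single j 1)
  have key : ∀ k l : Fin d, pd k (pd l f) y =
      fderiv ℝ (fderiv ℝ f) y (EuclideanSpace.single k 1) (EuclideanSpace.single l 1) := by
    intro k l
    change fderiv ℝ (fun z => fderiv ℝ f z (EuclideanSpace.single l 1)) y _ = _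
    rw [fderiv_clm_apply hd (differentiableAt_const _)]
    simp
  rw [key, key, hs]

lemma integral_pd_eq_zero (i : Fin d) (h : ContDiff ℝ ∞ f) (hc : HasCompactSupport f) :
    ∫ y, pd i f y = 0 := by
  have hi : Integrable (pd i f) := (h.pd i).continuous.integrable_of_hasCompactSupport (hc.pd i)
  have hf : Integrable f := h.continuous.integrable_of_hasCompactSupport hc
  -- Integration by parts against the constant function 1.
  have := integral_mul_fderiv_eq_neg_fderiv_mul_of_integrable (μ := volume)
    (f := fun _ : EuclideanSpace ℝ (Fin d) => (1 : ℝ)) (g := f)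
    (v := EuclideanSpace.single i (1 : ℝ)) (by simp)
    (by simp only [one_mul]; exact hi) (by simpa using hf)
    (fun _ _ => differentiableAt_const _) (fun _ _ => h.differentiable (by simp) _)
  simpa [pd] using this

lemma lap_mul (hdf : ∀ᶠ z in nhds y, ContDiffAt ℝ ∞ f z)
    (hdg : ∀ᶠ z in nhds y, ContDiffAt ℝ ∞ g z) :
    lap (fun z => f z * g z) y
      = f y * lap g y + 2 * ∑ i, pd i f y * pd i g y + g y * lap f y := by
  unfold lap
  rw [Finset.mul_sum, Finset.mul_sum, Finset.mul_sum, ← Finset.sum_add_distrib,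
    ← Finset.sum_add_distrib]
  refine Finset.sum_congr rfl fun i _ => ?_
  have hf := hdf.self_of_nhds
  have hg := hdg.self_of_nhds
  have h1 : pd i (fun z => f z * g z) =ᶠ[nhds y] fun z => pd i f z * g z + f z * pd i g z := by
    filter_upwards [hdf, hdg] with z hz hz'
    exact pd_mul i (hz.differentiableAt (by simp)) (hz'.differentiableAt (by simp))
  have a := hf.differentiableAt (by simp : (∞ : WithTop ℕ∞) ≠ 0)
  have b := hg.differentiableAt (by simp : (∞ : WithTop ℕ∞) ≠ 0)
  have a' := (hf.pd i).differentiableAt (by simp : (∞ : WithTop ℕ∞) ≠ 0)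
  have b' := (hg.pd i).differentiableAt (by simp : (∞ : WithTop ℕ∞) ≠ 0)
  rw [pd_congr i h1, pd_add i (a'.fun_mul b) (a.fun_mul b'), pd_mul i a' b, pd_mul i a b']
  ring

end Calculus

/-! ### Test functions away from the origin and the scale-invariant measure `r ^ (-d) dy`. -/

section Punctured

variable {d : ℕ} {F G q : EuclideanSpace ℝ (Fin d) → ℝ} {y : EuclideanSpace ℝ (Fin d)}

/-- Smooth functions with compact support in the punctured space. -/
structure PuncturedTest {d : ℕ} (F : EuclideanSpace ℝ (Fin d) → ℝ) : Prop where
  smooth : ContDiff ℝ ∞ F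
  zero : F =ᶠ[nhds 0] 0
  compact : HasCompactSupport F

namespace PuncturedTest

/-- Vanishing near the origin makes multiplication by singular radial weights harmless; this is the
reason for working in this class. -/
lemma mul_left (hF : PuncturedTest F) (hq : ∀ y ≠ 0, ContDiffAt ℝ ∞ q y) :
    PuncturedTest (fun y => q y * F y) := by
  have hz : (fun y => q y * F y) =ᶠ[nhds 0] 0 := by
    filter_upwards [hF.zero] with y hy
    simp [hy]
  refine ⟨contDiff_iff_contDiffAt.2 fun y => ?_, hz, hF.compact.mul_left⟩
  rcases eq_or_ne y 0 with rfl | hy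
  · exact (contDiffAt_const (c := (0 : ℝ))).congr_of_eventuallyEq hz
  · exact (hq y hy).mul hF.smooth.contDiffAt

lemma mul (hF : PuncturedTest F) (hG : PuncturedTest G) :
    PuncturedTest (fun y => F y * G y) :=
  hG.mul_left fun _ _ => hF.smooth.contDiffAt

lemma add (hF : PuncturedTest F) (hG : PuncturedTest G) :
    PuncturedTest (fun y => F y + G y) := by
  refine ⟨hF.smooth.add hG.smooth, ?_, hF.compact.add hG.compact⟩
  filter_upwards [hF.zero, hG.zero] with y hy hy'
  simp [hy, hy']

lemma sub (hF : PuncturedTest F) (hG : PuncturedTest G) :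
    PuncturedTest (fun y => F y - G y) := by
  refine ⟨hF.smooth.sub hG.smooth, ?_, hF.compact.sub hG.compact⟩
  filter_upwards [hF.zero, hG.zero] with y hy hy'
  simp [hy, hy']

lemma sum {ι : Type*} [DecidableEq ι] (s : Finset ι) {F : ι → EuclideanSpace ℝ (Fin d) → ℝ}
    (hF : ∀ i, PuncturedTest (F i)) : PuncturedTest (fun y => ∑ i ∈ s, F i y) := by
  induction s using Finset.induction_on with
  | empty =>
    simp only [Finset.sum_empty]
    exact ⟨contDiff_const, Filter.EventuallyEq.rfl, HasCompactSupport.zero⟩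
  | insert i s hi ih =>
    simp only [Finset.sum_insert hi]
    exact (hF i).add ih

lemma pd (hF : PuncturedTest F) (i : Fin d) : PuncturedTest (pd i F) := by
  refine ⟨hF.smooth.pd i, ?_, hF.compact.pd i⟩
  filter_upwards [hF.zero.fderiv (𝕜 := ℝ)] with y hy
  simp [_root_.pd, hy]

lemma eul (hF : PuncturedTest F) : PuncturedTest (eul F) := by
  have : _root_.eul F = fun y => ∑ i, y i * _root_.pd i F y := funext (eul_eq_sum F)
  rw [this]
  exact sum _ fun i => (hF.pd i).mul_left fun y _ => (contDiff_coord i).contDiffAt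

lemma lap (hF : PuncturedTest F) : PuncturedTest (lap F) :=
  sum _ fun i => (hF.pd i).pd i

lemma integrable (hF : PuncturedTest F) : Integrable F :=
  hF.smooth.continuous.integrable_of_hasCompactSupport hF.compact

lemma diff (hF : PuncturedTest F) : DifferentiableAt ℝ F y :=
  hF.smooth.differentiable (by simp) y

lemma apply_zero (hF : PuncturedTest F) : F 0 = 0 := hF.zero.self_of_nhds

end PuncturedTest

lemma contDiffAt_radial {A : ℝ → ℝ} (hA : ∀ s, 0 < s → ContDiffAt ℝ ∞ A s) :
    ∀ y : EuclideanSpace ℝ (Fin d), y ≠ 0 → ContDiffAt ℝ ∞ (fun y => A ‖y‖) y :=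
  fun y hy => (hA ‖y‖ (norm_pos_iff.2 hy)).comp y (contDiffAt_norm ℝ hy)

lemma contDiffAt_invPow (d : ℕ) : ∀ s : ℝ, 0 < s → ContDiffAt ℝ ∞ (fun s : ℝ => (s ^ d)⁻¹) s :=
  fun _ hs => (contDiffAt_id.pow d).inv (pow_pos hs d).ne'

lemma hasDerivAt_invPow (d : ℕ) {s : ℝ} (hs : 0 < s) :
    HasDerivAt (fun s : ℝ => (s ^ d)⁻¹) (-(d : ℝ) * (s ^ d)⁻¹ / s) s := by
  have := (hasDerivAt_pow d s).inv (pow_pos hs d).ne'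
  refine this.congr_deriv ?_
  rcases d with _ | d
  · simp
  · simp only [Nat.add_sub_cancel, pow_succ]
    field_simp

lemma eul_mul (hF : DifferentiableAt ℝ F y) (hG : DifferentiableAt ℝ G y) :
    eul (fun z => F z * G z) y = eul F y * G y + F y * eul G y := by
  unfold eul
  rw [fderiv_fun_mul hF hG]
  simp
  ring

lemma eul_sub (hF : DifferentiableAt ℝ F y) (hG : DifferentiableAt ℝ G y) :
    eul (fun z => F z - G z) y = eul F y - eul G y := by
  unfold eul
  rw [fderiv_fun_sub hF hG]
  simp

lemma eul_sum {ι : Type*} (s : Finset ι) {F : ι → EuclideanSpace ℝ (Fin d) → ℝ}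
    (hF : ∀ j ∈ s, DifferentiableAt ℝ (F j) y) :
    eul (fun z => ∑ j ∈ s, F j z) y = ∑ j ∈ s, eul (F j) y := by
  unfold eul
  rw [fderiv_fun_sum hF]
  simp

lemma eul_radial {A : ℝ → ℝ} {A' : ℝ} (hy : y ≠ 0) (hA : HasDerivAt A A' ‖y‖) :
    eul (fun z => A ‖z‖) y = A' * ‖y‖ := by
  have hn : ‖y‖ ≠ 0 := norm_ne_zero_iff.2 hy
  rw [eul_eq_sum]
  simp_rw [pd_radial _ hy hA]
  have : ∀ i, y i * (A' * (y i / ‖y‖)) = A' / ‖y‖ * (y i * y i) := fun i => by ring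
  simp_rw [this, ← Finset.mul_sum, sum_sq_eq_norm_sq]
  field_simp

/-- The field `‖y‖ ^ (-d) y` is divergence free off the origin, so only the derivative of `F`
survives. -/
lemma sum_pd_vectorField_radial (hF : PuncturedTest F) (hy : y ≠ 0) :
    ∑ i, pd i (fun z => (‖z‖ ^ d)⁻¹ * (z i * F z)) y = (‖y‖ ^ d)⁻¹ * eul F y := by
  have hr : 0 < ‖y‖ := norm_pos_iff.2 hy
  have hk : DifferentiableAt ℝ (fun z : EuclideanSpace ℝ (Fin d) => (‖z‖ ^ d)⁻¹) y :=
    differentiableAt_radial (A := fun s => (s ^ d)⁻¹) hy (hasDerivAt_invPow d hr).differentiableAt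
  have h : ∀ i, pd i (fun z => (‖z‖ ^ d)⁻¹ * (z i * F z)) y
      = (‖y‖ ^ d)⁻¹ * (y i * pd i F y) + (‖y‖ ^ d)⁻¹ * F y
        - (d * (‖y‖ ^ d)⁻¹ * F y / ‖y‖ ^ 2) * (y i * y i) := by
    intro i
    rw [pd_mul i hk ((differentiableAt_coord i).fun_mul hF.diff),
      pd_mul i (differentiableAt_coord i) hF.diff, pd_coord,
      pd_radial (A := fun s => (s ^ d)⁻¹) i hy (hasDerivAt_invPow d hr)]
    simp only [if_true]
    field_simp
    ring
  simp_rw [h, Finset.sum_sub_distrib, Finset.sum_add_distrib, ← Finset.mul_sum,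
    sum_sq_eq_norm_sq, ← eul_eq_sum]
  simp only [Finset.sum_const, Finset.card_univ, Fintype.card_fin, nsmul_eq_mul]
  field_simp
  ring

/-- Consequently the Euler derivative is skew for `r ^ (-d) dy`; in the variable `log r` it is plain
`∂ₜ`. -/
lemma integral_weight_eul (hF : PuncturedTest F) :
    ∫ y, (‖y‖ ^ d)⁻¹ * eul F y = 0 := by
  have hX : ∀ i : Fin d, PuncturedTest (fun z => (‖z‖ ^ d)⁻¹ * (z i * F z)) := fun i =>
    (hF.mul_left fun y _ => (contDiff_coord i).contDiffAt).mul_left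
      (contDiffAt_radial (contDiffAt_invPow d))
  have h : ∀ y, (‖y‖ ^ d)⁻¹ * eul F y
      = ∑ i, pd i (fun z => (‖z‖ ^ d)⁻¹ * (z i * F z)) y := by
    intro y
    rcases eq_or_ne y 0 with rfl | hy
    · simp [hF.eul.apply_zero, ((hX _).pd _).apply_zero]
    · exact (sum_pd_vectorField_radial hF hy).symm
  simp_rw [h]
  rw [integral_finsetSum _ fun i _ => ((hX i).pd i).integrable]
  exact Finset.sum_eq_zero fun i _ => integral_pd_eq_zero i (hX i).smooth (hX i).compact

lemma sum_pd_vectorField_grad (hF : PuncturedTest F) (hG : PuncturedTest G) (hy : y ≠ 0) :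
    ∑ i, pd i (fun z => ((‖z‖ ^ d)⁻¹ * ‖z‖ ^ 2) * (G z * pd i F z)) y
      = (‖y‖ ^ d)⁻¹ * (G y * (‖y‖ ^ 2 * lap F y - (d - 2) * eul F y)
        + ‖y‖ ^ 2 * ∑ i, pd i F y * pd i G y) := by
  have hr : 0 < ‖y‖ := norm_pos_iff.2 hy
  have hA : HasDerivAt (fun s : ℝ => (s ^ d)⁻¹ * s ^ 2) ((2 - d) * (‖y‖ ^ d)⁻¹ * ‖y‖) ‖y‖ := by
    refine ((hasDerivAt_invPow d hr).mul (hasDerivAt_pow 2 ‖y‖)).congr_deriv ?_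
    field_simp
    push_cast
    ring
  have h : ∀ i, pd i (fun z => ((‖z‖ ^ d)⁻¹ * ‖z‖ ^ 2) * (G z * pd i F z)) y
      = (2 - d) * (‖y‖ ^ d)⁻¹ * G y * (y i * pd i F y)
        + (‖y‖ ^ d)⁻¹ * ‖y‖ ^ 2 * G y * pd i (pd i F) y
        + (‖y‖ ^ d)⁻¹ * ‖y‖ ^ 2 * (pd i F y * pd i G y) := by
    intro i
    rw [pd_mul i (differentiableAt_radial (A := fun s => (s ^ d)⁻¹ * s ^ 2) hy
        hA.differentiableAt) (hG.diff.fun_mul (hF.pd i).diff),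
      pd_mul i hG.diff (hF.pd i).diff, pd_radial (A := fun s => (s ^ d)⁻¹ * s ^ 2) i hy hA]
    field_simp
    ring
  simp_rw [h, Finset.sum_add_distrib, ← Finset.mul_sum, ← eul_eq_sum]
  unfold lap
  ring

/-- In log-polar coordinates `r² Δ - (d - 2) r ∂ᵣ` is `∂ₜ² + Δ_S`, the Laplacian of the cylinder,
which is symmetric for `dt dω`. This is its Dirichlet form. -/
lemma integral_weight_lap (hF : PuncturedTest F) (hG : PuncturedTest G) :
    ∫ y, (‖y‖ ^ d)⁻¹ * (G y * (‖y‖ ^ 2 * lap F y - (d - 2) * eul F y)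
        + ‖y‖ ^ 2 * ∑ i, pd i F y * pd i G y) = 0 := by
  have hX : ∀ i : Fin d, PuncturedTest
      (fun z => ((‖z‖ ^ d)⁻¹ * ‖z‖ ^ 2) * (G z * pd i F z)) := fun i =>
    (hG.mul (hF.pd i)).mul_left (contDiffAt_radial (A := fun s => (s ^ d)⁻¹ * s ^ 2)
      fun s hs => (contDiffAt_invPow d s hs).mul (contDiffAt_id.pow 2))
  have h : ∀ y, (‖y‖ ^ d)⁻¹ * (G y * (‖y‖ ^ 2 * lap F y - (d - 2) * eul F y)
        + ‖y‖ ^ 2 * ∑ i, pd i F y * pd i G y)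
      = ∑ i, pd i (fun z => ((‖z‖ ^ d)⁻¹ * ‖z‖ ^ 2) * (G z * pd i F z)) y := by
    intro y
    rcases eq_or_ne y 0 with rfl | hy
    · simp only [((hX _).pd _).apply_zero]
      simp [hG.apply_zero]
    · exact (sum_pd_vectorField_grad hF hG hy).symm
  simp_rw [h]
  rw [integral_finsetSum _ fun i _ => ((hX i).pd i).integrable]
  exact Finset.sum_eq_zero fun i _ => integral_pd_eq_zero i (hX i).smooth (hX i).compact

end Punctured

/-! ### The Carleman estimate, by splitting the conjugated Laplacian into symmetric and skew parts.
-/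

section Carleman

variable {d : ℕ} {f g : EuclideanSpace ℝ (Fin d) → ℝ} {y : EuclideanSpace ℝ (Fin d)}

lemma pd_eul (i : Fin d) (hg : ContDiff ℝ ∞ g) : pd i (eul g) y = pd i g y + eul (pd i g) y := by
  have h : eul g = fun z => ∑ j, z j * pd j g z := funext (eul_eq_sum g)
  have hd : ∀ j, DifferentiableAt ℝ (pd j g) y := fun j =>
    (hg.pd j).differentiable (by simp) y
  rw [h, pd_sum _ i fun j _ => (differentiableAt_coord j).fun_mul (hd j)]
  have : ∀ j, pd i (fun z => z j * pd j g z) y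
      = (if i = j then pd j g y else 0) + y j * pd j (pd i g) y := by
    intro j
    rw [pd_mul i (differentiableAt_coord j) (hd j), pd_coord, pd_comm i j hg.contDiffAt]
    split_ifs <;> simp
  simp_rw [this, Finset.sum_add_distrib, ← eul_eq_sum]
  simp

/-- The skew part of the conjugated operator, with `a = α - σ r`. -/
noncomputable def skewPart (α σ : ℝ) (g : EuclideanSpace ℝ (Fin d) → ℝ)
    (y : EuclideanSpace ℝ (Fin d)) : ℝ :=
  2 * (α - σ * ‖y‖) * eul g y - σ * ‖y‖ * g y

/-- The symmetric part of the conjugated operator, with `a = α - σ r`. -/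
noncomputable def symmPart (α σ c : ℝ) (g : EuclideanSpace ℝ (Fin d) → ℝ)
    (y : EuclideanSpace ℝ (Fin d)) : ℝ :=
  ‖y‖ ^ 2 * lap g y - (d - 2) * eul g y + ((α - σ * ‖y‖) ^ 2 - c) * g y

lemma PuncturedTest.skewPart (α σ : ℝ) (hg : PuncturedTest g) :
    PuncturedTest (skewPart α σ g) :=
  (hg.eul.mul_left (q := fun y => 2 * (α - σ * ‖y‖)) (contDiffAt_radial
    (A := fun s => 2 * (α - σ * s)) fun _ _ => by fun_prop)).sub
  (hg.mul_left (q := fun y => σ * ‖y‖) (contDiffAt_radial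
    (A := fun s => σ * s) fun _ _ => by fun_prop))

lemma PuncturedTest.symmPart (α σ c : ℝ) (hg : PuncturedTest g) :
    PuncturedTest (symmPart α σ c g) :=
  ((hg.lap.mul_left (q := fun y => ‖y‖ ^ 2) (contDiffAt_radial
    (A := fun s => s ^ 2) fun _ _ => by fun_prop)).sub
  (hg.eul.mul_left (q := fun _ => (d - 2 : ℝ)) fun _ _ => contDiffAt_const)).add
  (hg.mul_left (q := fun y => (α - σ * ‖y‖) ^ 2 - c) (contDiffAt_radial
    (A := fun s => (α - σ * s) ^ 2 - c) fun _ _ => by fun_prop))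

lemma hasDerivAt_affine (α σ s : ℝ) : HasDerivAt (fun s : ℝ => α - σ * s) (-σ) s := by
  simpa using ((hasDerivAt_id s).const_mul σ).const_sub α

lemma sum_pd_mul_pd_skewPart (α σ : ℝ) (hg : PuncturedTest g) (hy : y ≠ 0) :
    ‖y‖ ^ 2 * ∑ i, pd i g y * pd i (skewPart α σ g) y
      = -2 * σ * ‖y‖ * eul g y ^ 2
        + 2 * (α - σ * ‖y‖) * ‖y‖ ^ 2 * (∑ i, pd i g y * pd i g y
          + ∑ i, pd i g y * eul (pd i g) y)
        - σ * ‖y‖ * g y * eul g y - σ * ‖y‖ * ‖y‖ ^ 2 * ∑ i, pd i g y * pd i g y := by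
  have hr : 0 < ‖y‖ := norm_pos_iff.2 hy
  have hA : HasDerivAt (fun s : ℝ => 2 * (α - σ * s)) (2 * (-σ)) ‖y‖ :=
    (hasDerivAt_affine α σ _).const_mul 2
  have hB : HasDerivAt (fun s : ℝ => σ * s) σ ‖y‖ := by
    simpa using (hasDerivAt_id ‖y‖).const_mul σ
  have dA := differentiableAt_radial hy hA.differentiableAt
  have dB := differentiableAt_radial hy hB.differentiableAt
  have h : ∀ i, pd i g y * pd i (skewPart α σ g) y
      = (-2 * σ * eul g y / ‖y‖ - σ * g y / ‖y‖) * (y i * pd i g y)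
        + (2 * (α - σ * ‖y‖) - σ * ‖y‖) * (pd i g y * pd i g y)
        + 2 * (α - σ * ‖y‖) * (pd i g y * eul (pd i g) y) := by
    intro i
    unfold skewPart
    rw [pd_sub i (dA.fun_mul hg.eul.diff) (dB.fun_mul hg.diff), pd_mul i dA hg.eul.diff,
      pd_mul i dB hg.diff, pd_radial i hy hA, pd_radial i hy hB, pd_eul i hg.smooth]
    field_simp
    ring
  simp_rw [h, Finset.sum_add_distrib, ← Finset.mul_sum, ← eul_eq_sum]
  field_simp
  ring

/-- The potential whose Euler derivative collects the terms that integrate to zero. -/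
noncomputable def carlemanPotential (α σ c : ℝ) (g : EuclideanSpace ℝ (Fin d) → ℝ)
    (y : EuclideanSpace ℝ (Fin d)) : ℝ :=
  (α - σ * ‖y‖) * ‖y‖ ^ 2 * ∑ i, pd i g y * pd i g y
    - (σ / 2 * ‖y‖ + (α - σ * ‖y‖) ^ 3 - c * (α - σ * ‖y‖)) * (g y * g y)

lemma PuncturedTest.carlemanPotential (α σ c : ℝ) (hg : PuncturedTest g) :
    PuncturedTest (carlemanPotential α σ c g) :=
  ((PuncturedTest.sum Finset.univ fun i => (hg.pd i).mul (hg.pd i)).mul_left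
    (q := fun y => (α - σ * ‖y‖) * ‖y‖ ^ 2) (contDiffAt_radial
      (A := fun s => (α - σ * s) * s ^ 2) fun _ _ => by fun_prop)).sub
  ((hg.mul hg).mul_left
    (q := fun y => σ / 2 * ‖y‖ + (α - σ * ‖y‖) ^ 3 - c * (α - σ * ‖y‖)) (contDiffAt_radial
      (A := fun s => σ / 2 * s + (α - σ * s) ^ 3 - c * (α - σ * s)) fun _ _ => by fun_prop))

lemma eul_carlemanPotential (α σ c : ℝ) (hg : PuncturedTest g) (hy : y ≠ 0) :
    eul (carlemanPotential α σ c g) y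
      = (2 * (α - σ * ‖y‖) * ‖y‖ ^ 2 - σ * ‖y‖ * ‖y‖ ^ 2) * ∑ i, pd i g y * pd i g y
        + 2 * (α - σ * ‖y‖) * ‖y‖ ^ 2 * ∑ i, pd i g y * eul (pd i g) y
        - (σ / 2 - 3 * σ * (α - σ * ‖y‖) ^ 2 + c * σ) * ‖y‖ * (g y * g y)
        - (σ / 2 * ‖y‖ + (α - σ * ‖y‖) ^ 3 - c * (α - σ * ‖y‖)) * (2 * g y * eul g y) := by
  have hA : HasDerivAt (fun s : ℝ => (α - σ * s) * s ^ 2)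
      (-σ * ‖y‖ ^ 2 + (α - σ * ‖y‖) * (2 * ‖y‖)) ‖y‖ :=
    ((hasDerivAt_affine α σ _).mul (hasDerivAt_pow 2 ‖y‖)).congr_deriv (by push_cast; ring)
  have hB : HasDerivAt (fun s : ℝ => σ / 2 * s + (α - σ * s) ^ 3 - c * (α - σ * s))
      (σ / 2 - 3 * σ * (α - σ * ‖y‖) ^ 2 + c * σ) ‖y‖ :=
    ((((hasDerivAt_id ‖y‖).const_mul (σ / 2)).add ((hasDerivAt_affine α σ _).pow 3)).sub
      ((hasDerivAt_affine α σ _).const_mul c)).congr_deriv (by push_cast; ring)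
  have dA := differentiableAt_radial hy hA.differentiableAt
  have dB := differentiableAt_radial hy hB.differentiableAt
  have hN : PuncturedTest (fun z => ∑ i, pd i g z * pd i g z) :=
    PuncturedTest.sum Finset.univ fun i => (hg.pd i).mul (hg.pd i)
  unfold carlemanPotential
  rw [eul_sub (dA.fun_mul hN.diff) (dB.fun_mul (hg.mul hg).diff), eul_mul dA hN.diff,
    eul_mul dB (hg.mul hg).diff, eul_radial hy hA, eul_radial hy hB, eul_mul hg.diff hg.diff,
    eul_sum _ fun i _ => ((hg.pd i).mul (hg.pd i)).diff]
  have h : ∀ i, eul (fun z => pd i g z * pd i g z) y = 2 * (pd i g y * eul (pd i g) y) := by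
    intro i
    rw [eul_mul (hg.pd i).diff (hg.pd i).diff]
    ring
  simp_rw [h, ← Finset.mul_sum]
  ring

/-- The right side is the quadratic form of the commutator of the two parts. It carries the factor
`σ`: a pure power weight (`σ = 0`) would yield nothing, and the factor `exp (-s / ρ)` is what
creates the gain. The constant `c` drops out. -/
lemma integral_symmPart_mul_skewPart (α σ c : ℝ) (hg : PuncturedTest g) :
    ∫ y, (‖y‖ ^ d)⁻¹ * (2 * (symmPart α σ c g y * skewPart α σ g y))
      = ∫ y, (‖y‖ ^ d)⁻¹ * (σ * ‖y‖ * (4 * eul g y ^ 2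
        + (4 * (α - σ * ‖y‖) ^ 2 - 1) * g y ^ 2)) := by
  have hb := hg.skewPart α σ
  have hk := contDiffAt_radial (d := d) (contDiffAt_invPow d)
  have h1 := integral_weight_lap hg hb
  have h2 := integral_weight_eul (hg.carlemanPotential α σ c)
  have i2 := ((hg.carlemanPotential α σ c).eul.mul_left hk).integrable
  have i0 : Integrable fun y : EuclideanSpace ℝ (Fin d) =>
      (‖y‖ ^ d)⁻¹ * (2 * (symmPart α σ c g y * skewPart α σ g y)) :=
    ((((hg.symmPart α σ c).mul hb).mul_left (q := fun _ => (2 : ℝ))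
      fun _ _ => contDiffAt_const).mul_left hk).integrable
  have i1 : Integrable fun y : EuclideanSpace ℝ (Fin d) =>
      (‖y‖ ^ d)⁻¹ * (skewPart α σ g y * (‖y‖ ^ 2 * lap g y - (d - 2) * eul g y)
        + ‖y‖ ^ 2 * ∑ i, pd i g y * pd i (skewPart α σ g) y) := by
    refine (((hb.mul ((hg.lap.mul_left (q := fun y => ‖y‖ ^ 2) (contDiffAt_radial
      (A := fun s => s ^ 2) fun _ _ => by fun_prop)).sub
      (hg.eul.mul_left (q := fun _ => (d - 2 : ℝ)) fun _ _ => contDiffAt_const))).add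
      ((PuncturedTest.sum Finset.univ fun i => (hg.pd i).mul (hb.pd i)).mul_left
        (q := fun y => ‖y‖ ^ 2) (contDiffAt_radial
      (A := fun s => s ^ 2) fun _ _ => by fun_prop))).mul_left hk).integrable
  -- The two integrands differ by a Dirichlet identity tested with `skewPart` and by an Euler
  -- derivative; both integrate to zero.
  have key : ∀ y : EuclideanSpace ℝ (Fin d),
      (‖y‖ ^ d)⁻¹ * (σ * ‖y‖ * (4 * eul g y ^ 2 + (4 * (α - σ * ‖y‖) ^ 2 - 1) * g y ^ 2))
      = (‖y‖ ^ d)⁻¹ * (2 * (symmPart α σ c g y * skewPart α σ g y))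
        - 2 * ((‖y‖ ^ d)⁻¹ * (skewPart α σ g y * (‖y‖ ^ 2 * lap g y - (d - 2) * eul g y)
        + ‖y‖ ^ 2 * ∑ i, pd i g y * pd i (skewPart α σ g) y))
        + 2 * ((‖y‖ ^ d)⁻¹ * eul (carlemanPotential α σ c g) y) := by
    intro y
    rcases eq_or_ne y 0 with rfl | hy
    · simp [hg.apply_zero, hb.apply_zero, (hg.carlemanPotential α σ c).eul.apply_zero]
    · rw [sum_pd_mul_pd_skewPart α σ hg hy, eul_carlemanPotential α σ c hg hy]
      unfold symmPart skewPart
      ring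
  simp_rw [key]
  have e1 := integral_sub i0 (i1.const_mul 2)
  have e2 := integral_add (i0.sub (i1.const_mul 2)) (i2.const_mul 2)
  simp only [Pi.sub_apply] at e2
  rw [e2, e1, integral_const_mul, integral_const_mul, h1, h2]
  ring

/-- The conjugated form of the Carleman estimate. -/
lemma integral_conjugated_ge (α σ c : ℝ) (hg : PuncturedTest g) :
    ∫ y, (‖y‖ ^ d)⁻¹ * (σ * ‖y‖ * (4 * eul g y ^ 2 + (4 * (α - σ * ‖y‖) ^ 2 - 1) * g y ^ 2))
      ≤ ∫ y, (‖y‖ ^ d)⁻¹ * (symmPart α σ c g y + skewPart α σ g y) ^ 2 := by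
  rw [← integral_symmPart_mul_skewPart α σ c hg]
  have hk := contDiffAt_radial (d := d) (contDiffAt_invPow d)
  have hb := hg.skewPart α σ
  have hs := hg.symmPart α σ c
  refine integral_mono ?_ ?_ ?_
  · exact (((hs.mul hb).mul_left (q := fun _ => (2 : ℝ))
      fun _ _ => contDiffAt_const).mul_left hk).integrable
  · simp_rw [pow_two]
    exact (((hs.add hb).mul (hs.add hb)).mul_left hk).integrable
  · intro y
    have : 0 ≤ (‖y‖ ^ d)⁻¹ := by positivity
    refine mul_le_mul_of_nonneg_left ?_ this
    nlinarith [sq_nonneg (symmPart α σ c g y), sq_nonneg (skewPart α σ g y)]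

/-- The factor conjugating the Laplacian; its square is, up to powers of the radius, the
Carleman weight. -/
noncomputable def conjFactor (γ σ s : ℝ) : ℝ := Real.exp (σ * s - γ * Real.log s)

lemma hasDerivAt_conjFactor (γ σ : ℝ) {s : ℝ} (hs : 0 < s) :
    HasDerivAt (conjFactor γ σ) (-(γ - σ * s) / s * conjFactor γ σ s) s := by
  have h := ((((hasDerivAt_id s).const_mul σ).sub
    ((Real.hasDerivAt_log hs.ne').const_mul γ))).exp
  refine h.congr_deriv ?_
  simp only [conjFactor]
  field_simp
  simp
  ring

lemma contDiffAt_conjFactor (γ σ : ℝ) : ∀ s : ℝ, 0 < s → ContDiffAt ℝ ∞ (conjFactor γ σ) s :=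
  fun _ hs => ((contDiffAt_const.mul contDiffAt_id).sub
    (contDiffAt_const.mul (Real.contDiffAt_log.2 hs.ne'))).exp

lemma lap_conjFactor (γ σ : ℝ) (hy : y ≠ 0) :
    lap (fun z : EuclideanSpace ℝ (Fin d) => conjFactor γ σ ‖z‖) y
      = conjFactor γ σ ‖y‖ * ((γ - σ * ‖y‖) ^ 2 + σ * ‖y‖ - (d - 2) * (γ - σ * ‖y‖))
        / ‖y‖ ^ 2 := by
  have hr : 0 < ‖y‖ := norm_pos_iff.2 hy
  have hev : ∀ᶠ z in nhds y, z ≠ 0 := isOpen_ne.mem_nhds hy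
  let A : ℝ → ℝ := fun s => -(γ - σ * s) / s ^ 2 * conjFactor γ σ s
  have hA : HasDerivAt A (conjFactor γ σ ‖y‖ *
      ((γ - σ * ‖y‖) ^ 2 + σ * ‖y‖ + 2 * (γ - σ * ‖y‖)) / ‖y‖ ^ 3) ‖y‖ := by
    have h := (((hasDerivAt_affine γ σ ‖y‖).neg.div (hasDerivAt_pow 2 ‖y‖)
      (pow_pos hr 2).ne')).mul (hasDerivAt_conjFactor γ σ hr)
    refine h.congr_deriv ?_
    simp only [Pi.neg_apply, Pi.div_apply]
    field_simp
    push_cast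
    ring
  have h : ∀ i, pd i (pd i (fun z : EuclideanSpace ℝ (Fin d) => conjFactor γ σ ‖z‖)) y
      = conjFactor γ σ ‖y‖ * ((γ - σ * ‖y‖) ^ 2 + σ * ‖y‖ + 2 * (γ - σ * ‖y‖)) / ‖y‖ ^ 4
        * (y i * y i) + A ‖y‖ := by
    intro i
    have h1 : pd i (fun z : EuclideanSpace ℝ (Fin d) => conjFactor γ σ ‖z‖)
        =ᶠ[nhds y] fun z => A ‖z‖ * z i := by
      filter_upwards [hev] with z hz
      have hz' : 0 < ‖z‖ := norm_pos_iff.2 hz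
      rw [pd_radial i hz (hasDerivAt_conjFactor γ σ hz')]
      simp only [A]
      field_simp
    rw [pd_congr i h1, pd_mul i (differentiableAt_radial hy hA.differentiableAt)
      (differentiableAt_coord i), pd_radial i hy hA, pd_coord]
    simp only [if_true]
    field_simp
  unfold lap
  simp_rw [h, Finset.sum_add_distrib, ← Finset.mul_sum, sum_sq_eq_norm_sq]
  simp only [Finset.sum_const, Finset.card_univ, Fintype.card_fin, nsmul_eq_mul, A]
  field_simp
  ring

/-- Completing the square: with `b = γ - σ r`, conjugation replaces `∂ₜ` by `∂ₜ + b` in `∂ₜ² + (d -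
2) ∂ₜ + Δ_S`. Since `α = γ + (d - 2) / 2`, this equals `(∂ₜ + a)² - (d - 2)² / 4 + Δ_S`, and
expanding `(∂ₜ + a)² = ∂ₜ² + 2a ∂ₜ - σ r + a²` separates the two parts. -/
lemma conjugation_identity (α σ : ℝ) (hf : PuncturedTest f) (hy : y ≠ 0) :
    symmPart α σ (((d : ℝ) - 2) ^ 2 / 4)
        (fun z => conjFactor (α - ((d : ℝ) - 2) / 2) σ ‖z‖ * f z) y
      + skewPart α σ (fun z => conjFactor (α - ((d : ℝ) - 2) / 2) σ ‖z‖ * f z) y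
      = conjFactor (α - ((d : ℝ) - 2) / 2) σ ‖y‖ * (‖y‖ ^ 2 * lap f y) := by
  set γ := α - ((d : ℝ) - 2) / 2 with hγ
  have hr : 0 < ‖y‖ := norm_pos_iff.2 hy
  have hev : ∀ᶠ z in nhds y, z ≠ 0 := isOpen_ne.mem_nhds hy
  have hM := hasDerivAt_conjFactor γ σ hr
  unfold symmPart skewPart
  rw [lap_mul (hev.mono (contDiffAt_radial (contDiffAt_conjFactor γ σ)))
    (Filter.Eventually.of_forall fun _ => hf.smooth.contDiffAt), lap_conjFactor γ σ hy,
    eul_mul (differentiableAt_radial hy hM.differentiableAt) hf.diff, eul_radial hy hM]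
  have h : ∀ i, pd i (fun z : EuclideanSpace ℝ (Fin d) => conjFactor γ σ ‖z‖) y * pd i f y
      = -(γ - σ * ‖y‖) / ‖y‖ ^ 2 * conjFactor γ σ ‖y‖ * (y i * pd i f y) := by
    intro i
    rw [pd_radial i hy hM]
    field_simp
  simp_rw [h, ← Finset.mul_sum, ← eul_eq_sum]
  have hα : α = γ + ((d : ℝ) - 2) / 2 := by rw [hγ]; ring
  rw [hα]
  field_simp
  ring

/-- The Carleman weight `w ^ (-2α)` for `w(s) = s * exp (-s / ρ)`. -/
noncomputable def carlemanWeight (α ρ s : ℝ) : ℝ := Real.exp (2 * α * (s / ρ - Real.log s))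

lemma contDiffAt_carlemanWeight (α ρ : ℝ) :
    ∀ s : ℝ, 0 < s → ContDiffAt ℝ ∞ (carlemanWeight α ρ) s := fun _ hs =>
  (contDiffAt_const.mul ((contDiffAt_id.div_const ρ).sub (Real.contDiffAt_log.2 hs.ne'))).exp

/-- The shift by `(d - 2) / 2` cancels the power `s ^ d`, so the final weight does not depend on the
dimension. -/
lemma conjFactor_sq (d : ℕ) (α ρ : ℝ) {s : ℝ} (hs : 0 < s) :
    (s ^ d)⁻¹ * conjFactor (α - ((d : ℝ) - 2) / 2) (α / ρ) s ^ 2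
      = carlemanWeight α ρ s * (s ^ 2)⁻¹ := by
  have h1 : ∀ n : ℕ, (s ^ n)⁻¹ = Real.exp (-(n * Real.log s)) := fun n => by
    rw [Real.exp_neg, Real.exp_nat_mul, Real.exp_log hs]
  rw [h1, h1, conjFactor, carlemanWeight, ← Real.exp_nat_mul, ← Real.exp_add, ← Real.exp_add]
  congr 1
  push_cast
  ring

/-- **Carleman estimate** for test functions supported in a punctured ball. -/
theorem carleman_estimate {α ρ : ℝ} (hα : 1 ≤ α) (hρ : 0 < ρ) (hf : PuncturedTest f)
    (hsupp : ∀ y, ρ / 2 ≤ ‖y‖ → f y = 0) :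
    ∫ y, (α ^ 3 - α) / ρ * (carlemanWeight α ρ ‖y‖ * ‖y‖⁻¹ * f y ^ 2)
      ≤ ∫ y, carlemanWeight α ρ ‖y‖ * ‖y‖ ^ 2 * lap f y ^ 2 := by
  set γ := α - ((d : ℝ) - 2) / 2
  set σ := α / ρ with hσ
  have hσ0 : 0 ≤ σ := by positivity
  have hg : PuncturedTest (fun z => conjFactor γ σ ‖z‖ * f z) :=
    hf.mul_left (contDiffAt_radial (contDiffAt_conjFactor γ σ))
  have hk := contDiffAt_radial (d := d) (contDiffAt_invPow d)
  have main := integral_conjugated_ge α σ (((d : ℝ) - 2) ^ 2 / 4) hg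
  have hR : ∀ y, (‖y‖ ^ d)⁻¹ * (symmPart α σ (((d : ℝ) - 2) ^ 2 / 4)
      (fun z => conjFactor γ σ ‖z‖ * f z) y + skewPart α σ
      (fun z => conjFactor γ σ ‖z‖ * f z) y) ^ 2
      = carlemanWeight α ρ ‖y‖ * ‖y‖ ^ 2 * lap f y ^ 2 := by
    intro y
    rcases eq_or_ne y 0 with rfl | hy
    · simp [(hg.skewPart α σ).apply_zero, (hg.symmPart α σ _).apply_zero]
    · have hr : 0 < ‖y‖ := norm_pos_iff.2 hy
      rw [conjugation_identity α σ hf hy]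
      have := conjFactor_sq d α ρ hr
      calc _ = ((‖y‖ ^ d)⁻¹ * conjFactor γ σ ‖y‖ ^ 2) * (‖y‖ ^ 4 * lap f y ^ 2) := by ring
        _ = _ := by
          rw [this]
          field_simp
  simp_rw [hR] at main
  refine le_trans (integral_mono ?_ ?_ ?_) main
  · simp_rw [pow_two]
    exact (((hf.mul hf).mul_left (q := fun y => carlemanWeight α ρ ‖y‖ * ‖y‖⁻¹)
      (contDiffAt_radial (A := fun s => carlemanWeight α ρ s * s⁻¹)
        fun s hs => (contDiffAt_carlemanWeight α ρ s hs).mul (contDiffAt_inv ℝ hs.ne'))).integrable).const_mul _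
  · simp_rw [pow_two]
    refine PuncturedTest.integrable (PuncturedTest.mul_left (PuncturedTest.mul_left
      (PuncturedTest.add ?_ ?_)
      (contDiffAt_radial (A := fun s => σ * s) fun _ _ => by fun_prop)) hk)
    · exact (hg.eul.mul hg.eul).mul_left fun _ _ => contDiffAt_const
    · exact (hg.mul hg).mul_left (q := fun y => 4 * ((α - σ * ‖y‖) * (α - σ * ‖y‖)) - 1)
        (contDiffAt_radial (A := fun s => 4 * ((α - σ * s) * (α - σ * s)) - 1)
          fun _ _ => by fun_prop)
  · intro y
    rcases eq_or_ne y 0 with rfl | hy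
    · simp
    have hr : 0 < ‖y‖ := norm_pos_iff.2 hy
    by_cases hfy : ρ / 2 ≤ ‖y‖
    · simp only [hsupp y hfy]
      simp
      positivity
    push Not at hfy
    -- The support condition `r < ρ / 2` keeps `a` above `α / 2`, so the coefficient of `g²` is at
    -- least `σ r (α² - 1)`. The nonnegative term in `eul` is discarded below.
    have h1 : 0 ≤ α - σ * ‖y‖ - α / 2 := by
      have : σ * ‖y‖ ≤ σ * (ρ / 2) := by gcongr
      have h2 : σ * (ρ / 2) = α / 2 := by rw [hσ]; field_simp
      linarith
    have h2 : α ^ 2 - 1 ≤ 4 * (α - σ * ‖y‖) ^ 2 - 1 := by nlinarith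
    have e1 : (‖y‖ ^ d)⁻¹ * (σ * ‖y‖ * ((α ^ 2 - 1) * (conjFactor γ σ ‖y‖ * f y) ^ 2))
        = (α ^ 3 - α) / ρ * (carlemanWeight α ρ ‖y‖ * ‖y‖⁻¹ * f y ^ 2) := by
      calc _ = ((‖y‖ ^ d)⁻¹ * conjFactor γ σ ‖y‖ ^ 2) * (σ * ‖y‖ * (α ^ 2 - 1) * f y ^ 2) := by
            ring
        _ = _ := by
          rw [conjFactor_sq d α ρ hr, hσ]
          field_simp
    simp only
    rw [← e1]
    gcongr
    nlinarith [sq_nonneg (eul (fun z => conjFactor γ σ ‖z‖ * f z) y),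
      mul_le_mul_of_nonneg_right h2 (sq_nonneg (conjFactor γ σ ‖y‖ * f y))]

end Carleman

/-! ### Radial cutoffs, and a Caccioppoli inequality for their commutators with the Laplacian. -/

section Cutoff

variable {d : ℕ} {f u χ : EuclideanSpace ℝ (Fin d) → ℝ} {y : EuclideanSpace ℝ (Fin d)}

lemma pd_comp_smul (i : Fin d) (c : ℝ) (f : EuclideanSpace ℝ (Fin d) → ℝ) :
    pd i (fun z => f (c • z)) = fun y => c * pd i f (c • y) := by
  funext y
  unfold pd
  rw [fderiv_comp_smul]
  simp

lemma pd_const_mul (i : Fin d) (c : ℝ) (f : EuclideanSpace ℝ (Fin d) → ℝ) :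
    pd i (fun z => c * f z) = fun y => c * pd i f y := by
  funext y
  unfold pd
  have : (fun z => c * f z) = c • f := rfl
  rw [this, fderiv_const_smul_field]
  simp

lemma lap_comp_smul (c : ℝ) (f : EuclideanSpace ℝ (Fin d) → ℝ) :
    lap (fun z => f (c • z)) y = c ^ 2 * lap f (c • y) := by
  unfold lap
  rw [Finset.mul_sum]
  refine Finset.sum_congr rfl fun i _ => ?_
  rw [pd_comp_smul, pd_const_mul, pd_comp_smul]
  ring

/-- The model bump function: `1` on the unit ball, `0` off the ball of radius `11/10`. -/
noncomputable def modelBump (d : ℕ) : ContDiffBump (0 : EuclideanSpace ℝ (Fin d)) :=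
  ⟨1, 11 / 10, by norm_num, by norm_num⟩

/-- The model bump function scaled to radius `l`. -/
noncomputable def cutoff (l : ℝ) (y : EuclideanSpace ℝ (Fin d)) : ℝ := modelBump d (l⁻¹ • y)

lemma contDiff_cutoff (l : ℝ) : ContDiff ℝ ∞ (cutoff l : EuclideanSpace ℝ (Fin d) → ℝ) :=
  (modelBump d).contDiff.comp (contDiff_const_smul l⁻¹)

lemma cutoff_nonneg (l : ℝ) : 0 ≤ cutoff l y := (modelBump d).nonneg

lemma cutoff_le_one (l : ℝ) : cutoff l y ≤ 1 := (modelBump d).le_one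

lemma cutoff_eq_one {l : ℝ} (hl : 0 < l) (h : ‖y‖ ≤ l) : cutoff l y = 1 := by
  refine (modelBump d).one_of_mem_closedBall ?_
  have : ‖l⁻¹ • y‖ ≤ 1 := by
    rw [norm_smul, Real.norm_of_nonneg (by positivity), inv_mul_le_iff₀ hl]
    simpa
  simpa [modelBump] using this

lemma cutoff_eq_zero {l : ℝ} (hl : 0 < l) (h : 11 / 10 * l ≤ ‖y‖) : cutoff l y = 0 := by
  refine (modelBump d).zero_of_le_dist ?_
  have : 11 / 10 ≤ ‖l⁻¹ • y‖ := by
    rw [norm_smul, Real.norm_of_nonneg (by positivity), le_inv_mul_iff₀ hl]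
    linarith
  simpa [modelBump] using this

lemma hasCompactSupport_cutoff {l : ℝ} (hl : 0 < l) :
    HasCompactSupport (cutoff l : EuclideanSpace ℝ (Fin d) → ℝ) := by
  refine HasCompactSupport.of_support_subset_isCompact
    (isCompact_closedBall (0 : EuclideanSpace ℝ (Fin d)) (11 / 10 * l)) fun y hy => ?_
  by_contra h
  refine hy (cutoff_eq_zero hl ?_)
  simp at h
  linarith

lemma pd_eq_zero_of_eventually_const (i : Fin d) {c : ℝ} (h : ∀ᶠ z in nhds y, f z = c) :
    ∀ᶠ z in nhds y, pd i f z = 0 := by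
  have h' : f =ᶠ[nhds y] fun _ => c := h
  filter_upwards [h'.fderiv (𝕜 := ℝ)] with z hz
  simp [pd, hz]

lemma lap_eq_zero_of_eventually_const {c : ℝ} (h : ∀ᶠ z in nhds y, f z = c) : lap f y = 0 :=
  Finset.sum_eq_zero fun i _ => (pd_eq_zero_of_eventually_const i
    (pd_eq_zero_of_eventually_const i h)).self_of_nhds

lemma cutoff_eventually_const {l : ℝ} (hl : 0 < l) (h : ‖y‖ < l ∨ 11 / 10 * l < ‖y‖) :
    ∃ c, ∀ᶠ z in nhds y, (cutoff l z : ℝ) = c := by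
  rcases h with h | h
  · refine ⟨1, ?_⟩
    filter_upwards [(isOpen_lt continuous_norm continuous_const).mem_nhds h] with z hz
    exact cutoff_eq_one hl (le_of_lt hz)
  · refine ⟨0, ?_⟩
    filter_upwards [(isOpen_lt continuous_const continuous_norm).mem_nhds h] with z hz
    exact cutoff_eq_zero hl (le_of_lt hz)

/-- All cutoffs are rescalings of one bump function per dimension, so the bound depends on `d`
alone. -/
lemma exists_cutoff_bound (d : ℕ) : ∃ B : ℝ, 0 ≤ B ∧ ∀ l : ℝ, 0 < l →
    ∀ y : EuclideanSpace ℝ (Fin d),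
      ∑ i, pd i (cutoff l) y ^ 2 ≤ B / l ^ 2 ∧ |lap (cutoff l) y| ≤ B / l ^ 2 := by
  have hb : ContDiff ℝ ∞ (modelBump d : EuclideanSpace ℝ (Fin d) → ℝ) := (modelBump d).contDiff
  have hbc : HasCompactSupport (modelBump d : EuclideanSpace ℝ (Fin d) → ℝ) :=
    (modelBump d).hasCompactSupport
  have hp : ∀ i, ∃ C, ∀ y, ‖pd i (modelBump d) y‖ ≤ C := fun i =>
    (hbc.pd i).exists_bound_of_continuous (hb.pd i).continuous
  have hq : ∀ i, ∃ C, ∀ y, ‖pd i (pd i (modelBump d)) y‖ ≤ C := fun i =>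
    ((hbc.pd i).pd i).exists_bound_of_continuous ((hb.pd i).pd i).continuous
  choose P hP using hp
  choose Q hQ using hq
  have hQ0 : 0 ≤ ∑ i, Q i := Finset.sum_nonneg fun i _ => (norm_nonneg _).trans (hQ i 0)
  have hP0 : 0 ≤ ∑ i, P i ^ 2 := Finset.sum_nonneg fun i _ => sq_nonneg _
  refine ⟨∑ i, P i ^ 2 + ∑ i, Q i, by positivity, fun l hl y => ⟨?_, ?_⟩⟩
  · have h1 : ∀ i, pd i (cutoff l) y ^ 2 ≤ P i ^ 2 / l ^ 2 := by
      intro i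
      unfold cutoff
      rw [pd_comp_smul, mul_pow, inv_pow, inv_mul_eq_div]
      gcongr ?_ / _
      exact sq_le_sq' (neg_le_of_abs_le (hP i _)) (le_of_abs_le (hP i _))
    calc _ ≤ ∑ i, P i ^ 2 / l ^ 2 := Finset.sum_le_sum fun i _ => h1 i
      _ = (∑ i, P i ^ 2) / l ^ 2 := by rw [Finset.sum_div]
      _ ≤ _ := by gcongr; linarith
  · unfold cutoff
    rw [lap_comp_smul, abs_mul, abs_of_nonneg (by positivity), inv_pow, inv_mul_eq_div]
    gcongr ?_ / _
    calc _ ≤ ∑ i, |pd i (pd i (modelBump d)) (l⁻¹ • y)| := Finset.abs_sum_le_sum_abs _ _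
      _ ≤ ∑ i, Q i := Finset.sum_le_sum fun i _ => hQ i _
      _ ≤ _ := by linarith

lemma HasCompactSupport.lap (hc : HasCompactSupport χ) : HasCompactSupport (lap χ) :=
  HasCompactSupport.intro hc fun _ hy =>
    lap_eq_zero_of_eventually_const (c := 0) (notMem_tsupport_iff_eventuallyEq.1 hy)

lemma integral_mul_lap_comm (hχ : ContDiff ℝ ∞ χ) (hc : HasCompactSupport χ)
    (hu : ContDiff ℝ ∞ u) : ∫ y, χ y * lap u y = ∫ y, u y * lap χ y := by
  have hX : ∀ i : Fin d, ContDiff ℝ ∞ (fun z => χ z * pd i u z - u z * pd i χ z) := fun i =>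
    (hχ.mul (hu.pd i)).sub (hu.mul (hχ.pd i))
  have hXc : ∀ i : Fin d, HasCompactSupport (fun z => χ z * pd i u z - u z * pd i χ z) := fun i =>
    (hc.mul_right (f' := pd i u)).sub ((hc.pd i).mul_left (f := u))
  have i1 : Integrable fun y => χ y * lap u y :=
    (hχ.mul hu.lap).continuous.integrable_of_hasCompactSupport (hc.mul_right (f' := lap u))
  have i2 : Integrable fun y => u y * lap χ y :=
    (hu.mul hχ.lap).continuous.integrable_of_hasCompactSupport (hc.lap.mul_left (f := u))
  rw [← sub_eq_zero, ← integral_sub i1 i2]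
  have h : ∀ y, χ y * lap u y - u y * lap χ y
      = ∑ i, pd i (fun z => χ z * pd i u z - u z * pd i χ z) y := by
    intro y
    have a := hχ.differentiable (by simp) y
    have b := hu.differentiable (by simp) y
    have a' := fun i => (hχ.pd i).differentiable (by simp) y
    have b' := fun i => (hu.pd i).differentiable (by simp) y
    unfold lap
    rw [Finset.mul_sum, Finset.mul_sum, ← Finset.sum_sub_distrib]
    refine Finset.sum_congr rfl fun i _ => ?_
    rw [pd_sub i (a.fun_mul (b' i)) (b.fun_mul (a' i)), pd_mul i a (b' i), pd_mul i b (a' i)]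
    ring
  simp_rw [h]
  rw [integral_finsetSum _ fun i _ =>
    ((hX i).pd i).continuous.integrable_of_hasCompactSupport ((hXc i).pd i)]
  exact Finset.sum_eq_zero fun i _ => integral_pd_eq_zero i (hX i) (hXc i)

/-- The energy identity behind the Caccioppoli inequality. -/
lemma integral_mul_grad_sq (hχ : ContDiff ℝ ∞ χ) (hc : HasCompactSupport χ)
    (hu : ContDiff ℝ ∞ u) :
    ∫ y, χ y * ∑ i, pd i u y ^ 2
      = ∫ y, (u y ^ 2 * lap χ y / 2 - χ y * (u y * lap u y)) := by
  -- Green's formula for `u²`, because `Δ(u²) = 2 u Δu + 2 |∇u|²`.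
  have h1 := integral_mul_lap_comm hχ hc (hu.mul hu)
  have hl : ∀ y, lap (fun z => u z * u z) y = 2 * (u y * lap u y) + 2 * ∑ i, pd i u y ^ 2 := by
    intro y
    have := Filter.Eventually.of_forall (f := nhds y) fun z => hu.contDiffAt (x := z)
    rw [lap_mul this this]
    simp_rw [pow_two]
    ring
  have i1 : Integrable fun y => u y ^ 2 * lap χ y :=
    ((hu.pow 2).mul hχ.lap).continuous.integrable_of_hasCompactSupport
      (hc.lap.mul_left (f := fun y => u y ^ 2))
  have i2 : Integrable fun y => χ y * (u y * lap u y) :=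
    (hχ.mul (hu.mul hu.lap)).continuous.integrable_of_hasCompactSupport
      (hc.mul_right (f' := fun y => u y * lap u y))
  have i3 : Integrable fun y => χ y * ∑ i, pd i u y ^ 2 :=
    (hχ.mul (ContDiff.sum fun i _ => (hu.pd i).pow 2)).continuous.integrable_of_hasCompactSupport
      (hc.mul_right (f' := fun y => ∑ i, pd i u y ^ 2))
  simp_rw [hl] at h1
  rw [integral_sub (i1.div_const 2) i2, integral_div]
  have e : ∀ y, χ y * (2 * (u y * lap u y) + 2 * ∑ i, pd i u y ^ 2)
      = 2 * (χ y * (u y * lap u y)) + 2 * (χ y * ∑ i, pd i u y ^ 2) := fun y => by ring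
  simp_rw [e, ← pow_two] at h1
  rw [integral_add (i2.const_mul 2) (i3.const_mul 2), integral_const_mul, integral_const_mul] at h1
  linarith

/-- The commutator of the Laplacian with multiplication by a cutoff. -/
noncomputable def cutoffCommutator (l : ℝ) (u : EuclideanSpace ℝ (Fin d) → ℝ)
    (y : EuclideanSpace ℝ (Fin d)) : ℝ :=
  2 * ∑ i, pd i (cutoff l) y * pd i u y + u y * lap (cutoff l) y

lemma cutoffCommutator_eq_zero {l : ℝ} (hl : 0 < l) (h : ‖y‖ < l ∨ 11 / 10 * l < ‖y‖) :
    cutoffCommutator l u y = 0 := by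
  obtain ⟨c, hc⟩ := cutoff_eventually_const hl h
  unfold cutoffCommutator
  rw [lap_eq_zero_of_eventually_const hc, Finset.sum_eq_zero fun i _ => by
    rw [(pd_eq_zero_of_eventually_const i hc).self_of_nhds, zero_mul]]
  simp

lemma continuous_cutoffCommutator (l : ℝ) (hu : ContDiff ℝ ∞ u) :
    Continuous (cutoffCommutator l u) :=
  (continuous_const.mul (continuous_finsetSum _ fun i _ =>
    ((contDiff_cutoff l).pd i).continuous.mul (hu.pd i).continuous)).add
    (hu.continuous.mul (contDiff_cutoff l).lap.continuous)

lemma integrable_cutoffCommutator_sq {l : ℝ} (hl : 0 < l) (hu : ContDiff ℝ ∞ u) :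
    Integrable fun y => cutoffCommutator l u y ^ 2 := by
  refine ((continuous_cutoffCommutator l hu).pow 2).integrable_of_hasCompactSupport ?_
  refine HasCompactSupport.intro
    (isCompact_closedBall (0 : EuclideanSpace ℝ (Fin d)) (11 / 10 * l)) fun y hy => ?_
  rw [Pi.pow_apply, cutoffCommutator_eq_zero hl (Or.inr (by simpa using hy))]
  simp

/-- The commutator contains `∇u`, but only on the shell `l ≤ ‖y‖ ≤ 11/10 l`. The energy identity
with a second cutoff, equal to 1 up to radius `11/10 l`, trades the gradient for `u` and `Δu`. The
second cutoff ends at `(11/10)² l`, whence the radius `121/100 l`. -/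
lemma integral_cutoffCommutator_sq_le (d : ℕ) : ∃ C : ℝ, 0 ≤ C ∧ ∀ l : ℝ, 0 < l →
    ∀ u : EuclideanSpace ℝ (Fin d) → ℝ, ContDiff ℝ ∞ u →
      ∫ y, cutoffCommutator l u y ^ 2
        ≤ ∫ y in Metric.closedBall 0 (121 / 100 * l),
            C / l ^ 4 * (u y ^ 2 + l ^ 4 * lap u y ^ 2) := by
  obtain ⟨B, hB, hBl⟩ := exists_cutoff_bound d
  refine ⟨8 * B * (B + 1) + 2 * B ^ 2, by positivity, fun l hl u hu => ?_⟩
  set m := 11 / 10 * l with hm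
  have hm0 : 0 < m := by positivity
  let S : Set (EuclideanSpace ℝ (Fin d)) := Metric.closedBall 0 (121 / 100 * l)
  have hS : MeasurableSet S := Metric.isClosed_closedBall.measurableSet
  have hχ := contDiff_cutoff (d := d) m
  have hc := hasCompactSupport_cutoff (d := d) hm0
  have cint : ∀ {F : EuclideanSpace ℝ (Fin d) → ℝ}, Continuous F → IntegrableOn F S := fun hF =>
    hF.continuousOn.integrableOn_compact (isCompact_closedBall _ _)
  have iu : IntegrableOn (fun y => u y ^ 2) S := cint (hu.continuous.pow 2)
  have il : IntegrableOn (fun y => lap u y ^ 2) S := cint (hu.lap.continuous.pow 2)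
  have inS : ∀ y ∉ S, m < ‖y‖ ∧ 11 / 10 * m < ‖y‖ := by
    intro y hy
    have : 121 / 100 * l < ‖y‖ := by simpa [S] using hy
    constructor <;> rw [hm] <;> linarith
  have hgrad : ∫ y, cutoff m y * ∑ i, pd i u y ^ 2
      ≤ ∫ y in S, (B + 1) / l ^ 2 * (u y ^ 2 + l ^ 4 * lap u y ^ 2) := by
    rw [integral_mul_grad_sq hχ hc hu, ← setIntegral_eq_integral_of_forall_compl_eq_zero (s := S)]
    · refine setIntegral_mono_on ?_ ((iu.add (il.const_mul _)).const_mul _) hS fun y _ => ?_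
      · exact cint ((((hu.continuous.pow 2).mul hχ.lap.continuous).div_const 2).sub
          (hχ.continuous.mul (hu.continuous.mul hu.lap.continuous)))
      · have h1 : lap (cutoff m) y ≤ B / l ^ 2 := by
          refine (le_of_abs_le (hBl m hm0 y).2).trans ?_
          gcongr
          rw [hm]
          linarith
        have h2 : -(cutoff m y * (u y * lap u y)) ≤ (u y ^ 2 + l ^ 4 * lap u y ^ 2) / l ^ 2 := by
          rw [le_div_iff₀ (by positivity)]
          have ha : |u y * (l ^ 2 * lap u y)| ≤ u y ^ 2 + l ^ 4 * lap u y ^ 2 := by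
            rw [abs_le]
            constructor <;> nlinarith [sq_nonneg (u y + l ^ 2 * lap u y),
              sq_nonneg (u y - l ^ 2 * lap u y), sq_nonneg (u y), sq_nonneg (l ^ 2 * lap u y)]
          have hb : |cutoff m y * (u y * (l ^ 2 * lap u y))| ≤ u y ^ 2 + l ^ 4 * lap u y ^ 2 := by
            rw [abs_mul, abs_of_nonneg (cutoff_nonneg m)]
            exact (mul_le_of_le_one_left (abs_nonneg _) (cutoff_le_one m)).trans ha
          have := neg_abs_le (cutoff m y * (u y * (l ^ 2 * lap u y)))
          nlinarith
        have h3 : u y ^ 2 * lap (cutoff m) y / 2 ≤ B / l ^ 2 * (u y ^ 2 + l ^ 4 * lap u y ^ 2) := by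
          have e1 : u y ^ 2 * lap (cutoff m) y ≤ u y ^ 2 * (B / l ^ 2) := by gcongr
          have e2 : 0 ≤ B / l ^ 2 * (l ^ 4 * lap u y ^ 2) := by positivity
          have e3 : 0 ≤ u y ^ 2 * (B / l ^ 2) := by positivity
          linarith
        have e : (B + 1) / l ^ 2 * (u y ^ 2 + l ^ 4 * lap u y ^ 2)
            = B / l ^ 2 * (u y ^ 2 + l ^ 4 * lap u y ^ 2)
              + (u y ^ 2 + l ^ 4 * lap u y ^ 2) / l ^ 2 := by ring
        rw [e]
        linarith
    · intro y hy
      obtain ⟨c, hc'⟩ := cutoff_eventually_const hm0 (Or.inr (inS y hy).2)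
      rw [lap_eq_zero_of_eventually_const hc', cutoff_eq_zero hm0 (inS y hy).2.le]
      ring
  have i3 : Integrable fun y => cutoff m y * ∑ i, pd i u y ^ 2 :=
    (hχ.mul (ContDiff.sum fun i _ => (hu.pd i).pow 2)).continuous.integrable_of_hasCompactSupport
      (hc.mul_right (f' := fun y => ∑ i, pd i u y ^ 2))
  -- Inside radius `m` the second cutoff is 1 and Cauchy–Schwarz applies; outside, the commutator
  -- vanishes.
  have hpt : ∀ y, cutoffCommutator l u y ^ 2
      ≤ 8 * B / l ^ 2 * (cutoff m y * ∑ i, pd i u y ^ 2)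
        + S.indicator (fun y => 2 * B ^ 2 / l ^ 4 * (u y ^ 2 + l ^ 4 * lap u y ^ 2)) y := by
    intro y
    have hN : 0 ≤ ∑ i, pd i u y ^ 2 := Finset.sum_nonneg fun i _ => sq_nonneg _
    by_cases hy : ‖y‖ ≤ m
    · have hyS : y ∈ S := by
        by_contra h
        exact absurd (inS y h).1 (not_lt.2 hy)
      rw [Set.indicator_of_mem hyS, cutoff_eq_one hm0 hy, one_mul]
      obtain ⟨h1, h2⟩ := hBl l hl y
      have cs := Finset.sum_mul_sq_le_sq_mul_sq Finset.univ
        (fun i => pd i (cutoff l) y) (fun i => pd i u y)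
      have h3 : (∑ i, pd i (cutoff l) y * pd i u y) ^ 2 ≤ B / l ^ 2 * ∑ i, pd i u y ^ 2 :=
        cs.trans (by gcongr)
      have h4 : lap (cutoff l) y ^ 2 ≤ (B / l ^ 2) ^ 2 :=
        sq_le_sq' (neg_le_of_abs_le h2) (le_of_abs_le h2)
      have h5 : (u y * lap (cutoff l) y) ^ 2 ≤ B ^ 2 / l ^ 4 * (u y ^ 2) := by
        rw [mul_pow]
        calc _ ≤ u y ^ 2 * (B / l ^ 2) ^ 2 := by gcongr
          _ = _ := by ring
      have h6 : 0 ≤ B ^ 2 / l ^ 4 * (l ^ 4 * lap u y ^ 2) := by positivity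
      unfold cutoffCommutator
      have e1 : 8 * B / l ^ 2 * ∑ i, pd i u y ^ 2 = 8 * (B / l ^ 2 * ∑ i, pd i u y ^ 2) := by ring
      have e2 : 2 * B ^ 2 / l ^ 4 * (u y ^ 2 + l ^ 4 * lap u y ^ 2)
        = 2 * (B ^ 2 / l ^ 4 * u y ^ 2) + 2 * (B ^ 2 / l ^ 4 * (l ^ 4 * lap u y ^ 2)) := by ring
      rw [e1, e2]
      nlinarith [sq_nonneg (2 * ∑ i, pd i (cutoff l) y * pd i u y - u y * lap (cutoff l) y)]
    · rw [cutoffCommutator_eq_zero hl (Or.inr (lt_of_not_ge hy))]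
      have h1 := cutoff_nonneg m (y := y)
      have h2 : 0 ≤ S.indicator
          (fun y => 2 * B ^ 2 / l ^ 4 * (u y ^ 2 + l ^ 4 * lap u y ^ 2)) y :=
        Set.indicator_nonneg (fun y _ => by positivity) y
      have h3 : 0 ≤ 8 * B / l ^ 2 * (cutoff m y * ∑ i, pd i u y ^ 2) := by positivity
      simpa using add_nonneg h3 h2
  have i4 : IntegrableOn (fun y => 2 * B ^ 2 / l ^ 4 * (u y ^ 2 + l ^ 4 * lap u y ^ 2)) S :=
    (iu.add (il.const_mul _)).const_mul _
  calc _ ≤ ∫ y, (8 * B / l ^ 2 * (cutoff m y * ∑ i, pd i u y ^ 2)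
        + S.indicator (fun y => 2 * B ^ 2 / l ^ 4 * (u y ^ 2 + l ^ 4 * lap u y ^ 2)) y) :=
        integral_mono (integrable_cutoffCommutator_sq hl hu)
          ((i3.const_mul _).add (i4.integrable_indicator hS)) hpt
    _ = 8 * B / l ^ 2 * (∫ y, cutoff m y * ∑ i, pd i u y ^ 2)
        + ∫ y in S, 2 * B ^ 2 / l ^ 4 * (u y ^ 2 + l ^ 4 * lap u y ^ 2) := by
        rw [integral_add (i3.const_mul _) (i4.integrable_indicator hS), integral_const_mul,
          integral_indicator hS]
    _ ≤ 8 * B / l ^ 2 * (∫ y in S, (B + 1) / l ^ 2 * (u y ^ 2 + l ^ 4 * lap u y ^ 2))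
        + ∫ y in S, 2 * B ^ 2 / l ^ 4 * (u y ^ 2 + l ^ 4 * lap u y ^ 2) := by
        gcongr
    _ = _ := by
        change _ = ∫ y in S, _
        rw [integral_const_mul, integral_const_mul, integral_const_mul]
        ring

end Cutoff

/-! ### The Carleman estimate for a smooth function cut off to an annulus. -/

section SmoothEstimate

variable {d : ℕ} {f u : EuclideanSpace ℝ (Fin d) → ℝ} {y : EuclideanSpace ℝ (Fin d)}

lemma carlemanWeight_pos (α ρ s : ℝ) : 0 < carlemanWeight α ρ s := Real.exp_pos _

/-- The exponent `s / ρ - log s` decreases on `(0, ρ]`; this is the inequality `1 - s / t ≤ log (t /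
s)`. -/
lemma carlemanWeight_anti {α ρ s t : ℝ} (hα : 0 ≤ α) (hs : 0 < s) (hst : s ≤ t) (ht : t ≤ ρ) :
    carlemanWeight α ρ t ≤ carlemanWeight α ρ s := by
  have ht0 : 0 < t := hs.trans_le hst
  have hρ : 0 < ρ := ht0.trans_le ht
  refine Real.exp_le_exp.2 (mul_le_mul_of_nonneg_left ?_ (by positivity))
  have h1 := Real.one_sub_inv_le_log_of_pos (div_pos ht0 hs)
  rw [Real.log_div ht0.ne' hs.ne', inv_div] at h1
  have h2 : (t - s) / ρ ≤ (t - s) / t := by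
    gcongr
  have h3 : (t - s) / t = 1 - s / t := by field_simp
  have h4 : (t - s) / ρ = t / ρ - s / ρ := by ring
  linarith

/-- A cutoff to an annulus around the origin. -/
noncomputable def annulusCutoff (l₁ l₂ : ℝ) (y : EuclideanSpace ℝ (Fin d)) : ℝ :=
  cutoff l₂ y - cutoff l₁ y

lemma puncturedTest_annulusCutoff {l₁ l₂ : ℝ} (h₁ : 0 < l₁) (h₂ : l₁ ≤ l₂) :
    PuncturedTest (annulusCutoff l₁ l₂ : EuclideanSpace ℝ (Fin d) → ℝ) := by
  refine ⟨(contDiff_cutoff l₂).sub (contDiff_cutoff l₁), ?_,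
    (hasCompactSupport_cutoff (h₁.trans_le h₂)).sub (hasCompactSupport_cutoff h₁)⟩
  filter_upwards [Metric.ball_mem_nhds (0 : EuclideanSpace ℝ (Fin d)) h₁] with y hy
  have hy' : ‖y‖ ≤ l₁ := by simpa using (Metric.mem_ball.1 hy).le
  simp [annulusCutoff, cutoff_eq_one h₁ hy', cutoff_eq_one (h₁.trans_le h₂) (hy'.trans h₂)]

lemma annulusCutoff_eq_one {l₁ l₂ : ℝ} (h₁ : 0 < l₁) (h₂ : l₁ ≤ l₂) (h : 11 / 10 * l₁ ≤ ‖y‖)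
    (h' : ‖y‖ ≤ l₂) : annulusCutoff l₁ l₂ y = 1 := by
  simp [annulusCutoff, cutoff_eq_zero h₁ h, cutoff_eq_one (h₁.trans_le h₂) h']

lemma annulusCutoff_eq_zero {l₁ l₂ : ℝ} (h₁ : 0 < l₁) (h₂ : l₁ ≤ l₂) (h : 11 / 10 * l₂ ≤ ‖y‖) :
    annulusCutoff l₁ l₂ y = 0 := by
  simp [annulusCutoff, cutoff_eq_zero h₁ ((by linarith : 11 / 10 * l₁ ≤ 11 / 10 * l₂).trans h),
    cutoff_eq_zero (h₁.trans_le h₂) h]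

lemma lap_annulusCutoff_mul (l₁ l₂ : ℝ) (hu : ContDiff ℝ ∞ u) :
    lap (fun z => annulusCutoff l₁ l₂ z * u z) y
      = annulusCutoff l₁ l₂ y * lap u y + cutoffCommutator l₂ u y - cutoffCommutator l₁ u y := by
  have hη : ContDiff ℝ ∞ (annulusCutoff l₁ l₂ : EuclideanSpace ℝ (Fin d) → ℝ) :=
    (contDiff_cutoff l₂).sub (contDiff_cutoff l₁)
  have hd : ∀ (l : ℝ) (z : EuclideanSpace ℝ (Fin d)), DifferentiableAt ℝ (cutoff l) z := fun l z =>
    (contDiff_cutoff l).differentiable (by simp) z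
  have hpd : ∀ i, pd i (annulusCutoff l₁ l₂) = fun z : EuclideanSpace ℝ (Fin d) =>
      pd i (cutoff l₂) z - pd i (cutoff l₁) z := fun i =>
    funext fun z => pd_sub i (hd l₂ z) (hd l₁ z)
  have hlap : lap (annulusCutoff l₁ l₂) y = lap (cutoff l₂) y - lap (cutoff l₁) y := by
    unfold lap
    rw [← Finset.sum_sub_distrib]
    refine Finset.sum_congr rfl fun i _ => ?_
    rw [hpd, pd_sub i (((contDiff_cutoff l₂).pd i).differentiable (by simp) y)
      (((contDiff_cutoff l₁).pd i).differentiable (by simp) y)]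
  rw [lap_mul (Filter.Eventually.of_forall fun z => hη.contDiffAt)
    (Filter.Eventually.of_forall fun z => hu.contDiffAt), hlap]
  simp_rw [hpd, sub_mul, Finset.sum_sub_distrib]
  unfold cutoffCommutator
  ring

/-- The coefficient of the error made by a cutoff at radius `l`. -/
noncomputable def errorCoeff (C α ρ l : ℝ) : EuclideanSpace ℝ (Fin d) → ℝ :=
  (Metric.closedBall 0 (121 / 100 * l)).indicator fun _ => C * carlemanWeight α ρ l / l ^ 2

/-- On the shell carrying the commutator the weight is at most its value at `l`, and `‖y‖² ≤
(11/10)² l² ≤ 5/4 l²`. -/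
lemma carlemanWeight_mul_cutoffCommutator_le {α ρ l : ℝ} (hα : 0 ≤ α) (hl : 0 < l)
    (hρ : 11 / 10 * l ≤ ρ) :
    carlemanWeight α ρ ‖y‖ * ‖y‖ ^ 2 * cutoffCommutator l u y ^ 2
      ≤ 5 / 4 * carlemanWeight α ρ l * l ^ 2 * cutoffCommutator l u y ^ 2 := by
  by_cases h : ‖y‖ < l ∨ 11 / 10 * l < ‖y‖
  · simp [cutoffCommutator_eq_zero hl h]
  · push Not at h
    have h1 := carlemanWeight_anti hα hl h.1 (h.2.trans hρ)
    have h2 : ‖y‖ ^ 2 ≤ 5 / 4 * l ^ 2 := by nlinarith [h.1, h.2]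
    have h0 := carlemanWeight_pos α ρ ‖y‖
    calc _ ≤ carlemanWeight α ρ l * (5 / 4 * l ^ 2) * cutoffCommutator l u y ^ 2 := by
          gcongr
          exact h0.le.trans h1
      _ = _ := by ring

/-- The Carleman estimate for functions that are smooth but not compactly supported. -/
theorem carleman_estimate_cutoff (d : ℕ) : ∃ C : ℝ, 0 ≤ C ∧ ∀ α ρ l₁ l₂ : ℝ, 1 ≤ α → 0 < ρ →
    0 < l₁ → l₁ ≤ l₂ → 11 / 10 * l₂ ≤ ρ / 2 →
    ∀ u : EuclideanSpace ℝ (Fin d) → ℝ, ContDiff ℝ ∞ u →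
      ∫ y, (α ^ 3 - α) / ρ * (carlemanWeight α ρ ‖y‖ * ‖y‖⁻¹ * annulusCutoff l₁ l₂ y ^ 2) * u y ^ 2
      ≤ (∫ y, (2 * (carlemanWeight α ρ ‖y‖ * ‖y‖ ^ 2 * annulusCutoff l₁ l₂ y ^ 2)
            + l₁ ^ 4 * errorCoeff C α ρ l₁ y + l₂ ^ 4 * errorCoeff C α ρ l₂ y) * lap u y ^ 2)
        + ∫ y, (errorCoeff C α ρ l₁ y + errorCoeff C α ρ l₂ y) * u y ^ 2 := by
  obtain ⟨C, hC, hJ⟩ := integral_cutoffCommutator_sq_le d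
  refine ⟨5 * C, by positivity, fun α ρ l₁ l₂ hα hρ h₁ h₂ h₃ u hu => ?_⟩
  have h₂0 : 0 < l₂ := h₁.trans_le h₂
  have hα0 : 0 ≤ α := by linarith
  have hη := puncturedTest_annulusCutoff (d := d) h₁ h₂
  have hf : PuncturedTest (fun y => annulusCutoff l₁ l₂ y * u y) :=
    ⟨hη.smooth.mul hu, by
      filter_upwards [hη.zero] with y hy
      simp [hy], hη.compact.mul_right⟩
  have hfl : PuncturedTest (fun y => annulusCutoff l₁ l₂ y * lap u y) :=
    ⟨hη.smooth.mul hu.lap, by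
      filter_upwards [hη.zero] with y hy
      simp [hy], hη.compact.mul_right⟩
  have main := carleman_estimate hα hρ hf fun y hy => by
    rw [annulusCutoff_eq_zero h₁ h₂ (h₃.trans hy), zero_mul]
  have hwr := contDiffAt_radial (d := d) (A := fun s => carlemanWeight α ρ s * s ^ 2)
    fun s hs => (contDiffAt_carlemanWeight α ρ s hs).mul (contDiffAt_id.pow 2)
  have e1 : ∀ y, (α ^ 3 - α) / ρ * (carlemanWeight α ρ ‖y‖ * ‖y‖⁻¹ * annulusCutoff l₁ l₂ y ^ 2)
        * u y ^ 2
      = (α ^ 3 - α) / ρ * (carlemanWeight α ρ ‖y‖ * ‖y‖⁻¹ * (annulusCutoff l₁ l₂ y * u y) ^ 2) :=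
    fun y => by ring
  simp_rw [e1]
  refine main.trans ?_
  have iA : Integrable fun y : EuclideanSpace ℝ (Fin d) =>
      2 * (carlemanWeight α ρ ‖y‖ * ‖y‖ ^ 2 * annulusCutoff l₁ l₂ y ^ 2) * lap u y ^ 2 := by
    refine ((hfl.mul hfl).mul_left hwr).integrable.const_mul 2 |>.congr
      (Filter.Eventually.of_forall fun y => ?_)
    simp only
    ring
  have iJ : ∀ l, 0 < l → Integrable fun y : EuclideanSpace ℝ (Fin d) =>
      5 * carlemanWeight α ρ l * l ^ 2 * cutoffCommutator l u y ^ 2 := fun l hl =>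
    (integrable_cutoffCommutator_sq hl hu).const_mul _
  have cint : ∀ (l : ℝ) {F : EuclideanSpace ℝ (Fin d) → ℝ}, Continuous F →
      Integrable fun y => errorCoeff (5 * C) α ρ l y * F y := by
    intro l F hF
    have : (fun y => errorCoeff (5 * C) α ρ l y * F y)
        = (Metric.closedBall 0 (121 / 100 * l)).indicator
          fun y => 5 * C * carlemanWeight α ρ l / l ^ 2 * F y := by
      funext y
      unfold errorCoeff
      rw [← Set.indicator_mul_left]
    rw [this]
    exact IntegrableOn.integrable_indicator ((continuous_const.mul hF).continuousOn.integrableOn_compact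
      (isCompact_closedBall _ _)) Metric.isClosed_closedBall.measurableSet
  have iu : ∀ l, Integrable fun y => errorCoeff (5 * C) α ρ l y * u y ^ 2 :=
    fun l => cint l (hu.continuous.pow 2)
  have il : ∀ l, Integrable fun y => errorCoeff (5 * C) α ρ l y * lap u y ^ 2 :=
    fun l => cint l (hu.lap.continuous.pow 2)
  have hJ' : ∀ l, 0 < l → ∫ y, 5 * carlemanWeight α ρ l * l ^ 2 * cutoffCommutator l u y ^ 2
      ≤ (∫ y, l ^ 4 * errorCoeff (5 * C) α ρ l y * lap u y ^ 2)
        + ∫ y, errorCoeff (5 * C) α ρ l y * u y ^ 2 := by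
    intro l hl
    have hw := carlemanWeight_pos α ρ l
    have h4 : Integrable fun y => l ^ 4 * errorCoeff (5 * C) α ρ l y * lap u y ^ 2 := by
      simp_rw [mul_assoc]
      exact (il l).const_mul _
    rw [← integral_add h4 (iu l), integral_const_mul]
    calc _ ≤ 5 * carlemanWeight α ρ l * l ^ 2 * _ :=
          mul_le_mul_of_nonneg_left (hJ l hl u hu) (by positivity)
      _ = _ := by
        rw [← integral_const_mul, ← integral_indicator Metric.isClosed_closedBall.measurableSet]
        refine integral_congr_ae (Filter.Eventually.of_forall fun y => ?_)
        by_cases hy : y ∈ Metric.closedBall (0 : EuclideanSpace ℝ (Fin d)) (121 / 100 * l)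
        · simp only [errorCoeff, Set.indicator_of_mem hy]
          field_simp
          ring
        · simp only [errorCoeff, Set.indicator_of_notMem hy]
          ring
  have hpt : ∀ y : EuclideanSpace ℝ (Fin d), carlemanWeight α ρ ‖y‖ * ‖y‖ ^ 2
      * lap (fun z => annulusCutoff l₁ l₂ z * u z) y ^ 2
      ≤ 2 * (carlemanWeight α ρ ‖y‖ * ‖y‖ ^ 2 * annulusCutoff l₁ l₂ y ^ 2) * lap u y ^ 2
        + (5 * carlemanWeight α ρ l₁ * l₁ ^ 2 * cutoffCommutator l₁ u y ^ 2
          + 5 * carlemanWeight α ρ l₂ * l₂ ^ 2 * cutoffCommutator l₂ u y ^ 2) := by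
    intro y
    rw [lap_annulusCutoff_mul l₁ l₂ hu]
    have a1 := carlemanWeight_mul_cutoffCommutator_le (y := y) (u := u) hα0 h₁
      (by linarith : 11 / 10 * l₁ ≤ ρ)
    have a2 := carlemanWeight_mul_cutoffCommutator_le (y := y) (u := u) hα0 h₂0
      (by linarith : 11 / 10 * l₂ ≤ ρ)
    have hw : 0 ≤ carlemanWeight α ρ ‖y‖ * ‖y‖ ^ 2 := by
      have := carlemanWeight_pos α ρ ‖y‖
      positivity
    -- The coefficient 4 of the commutators here times the `5/4` from the shell gives the factor 5
    -- in the constant.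
    have key : (annulusCutoff l₁ l₂ y * lap u y + cutoffCommutator l₂ u y
        - cutoffCommutator l₁ u y) ^ 2 ≤ 2 * (annulusCutoff l₁ l₂ y ^ 2 * lap u y ^ 2)
          + 4 * cutoffCommutator l₁ u y ^ 2 + 4 * cutoffCommutator l₂ u y ^ 2 := by
      nlinarith [sq_nonneg (annulusCutoff l₁ l₂ y * lap u y
        - (cutoffCommutator l₂ u y - cutoffCommutator l₁ u y)),
        sq_nonneg (cutoffCommutator l₂ u y + cutoffCommutator l₁ u y)]
    have := mul_le_mul_of_nonneg_left key hw
    linarith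
  have e2 : ∀ y, (2 * (carlemanWeight α ρ ‖y‖ * ‖y‖ ^ 2 * annulusCutoff l₁ l₂ y ^ 2)
            + l₁ ^ 4 * errorCoeff (5 * C) α ρ l₁ y + l₂ ^ 4 * errorCoeff (5 * C) α ρ l₂ y)
            * lap u y ^ 2
      = 2 * (carlemanWeight α ρ ‖y‖ * ‖y‖ ^ 2 * annulusCutoff l₁ l₂ y ^ 2) * lap u y ^ 2
        + (l₁ ^ 4 * errorCoeff (5 * C) α ρ l₁ y * lap u y ^ 2
          + l₂ ^ 4 * errorCoeff (5 * C) α ρ l₂ y * lap u y ^ 2) := fun y => by ring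
  have i4 : ∀ l, Integrable fun y => l ^ 4 * errorCoeff (5 * C) α ρ l y * lap u y ^ 2 := by
    intro l
    simp_rw [mul_assoc]
    exact (il l).const_mul _
  simp_rw [e2, add_mul]
  have e5 := integral_add iA ((i4 l₁).add (i4 l₂))
  simp only [Pi.add_apply] at e5
  rw [e5, integral_add (i4 l₁) (i4 l₂), integral_add (iu l₁) (iu l₂)]
  have hI := integral_mono (((hf.lap.mul hf.lap).mul_left hwr).integrable.congr
      (Filter.Eventually.of_forall fun y => by simp only [pow_two]))
    (iA.add ((iJ l₁ h₁).add (iJ l₂ h₂0))) hpt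
  have e3 := integral_add iA ((iJ l₁ h₁).add (iJ l₂ h₂0))
  have e4 := integral_add (iJ l₁ h₁) (iJ l₂ h₂0)
  simp only [Pi.add_apply] at hI e3 e4
  rw [e3, e4] at hI
  have b1 := hJ' l₁ h₁
  have b2 := hJ' l₂ h₂0
  linarith

end SmoothEstimate

/-! ### Mollification in `L²` and passage from smooth to weak inequalities. -/

section Mollify

open Filter
open scoped Convolution Topology ENNReal

variable {d : ℕ} {F H φ : EuclideanSpace ℝ (Fin d) → ℝ}

/-- Convolution of real functions on Euclidean space. -/
noncomputable def mollify (F φ : EuclideanSpace ℝ (Fin d) → ℝ) : EuclideanSpace ℝ (Fin d) → ℝ :=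
  F ⋆[ContinuousLinearMap.mul ℝ ℝ, volume] φ

lemma contDiff_mollify (hF : LocallyIntegrable F) (hφ : ContDiff ℝ ∞ φ)
    (hc : HasCompactSupport φ) : ContDiff ℝ ∞ (mollify F φ) :=
  hc.contDiff_convolution_right _ hF hφ

lemma pd_mollify (i : Fin d) (hF : LocallyIntegrable F) (hφ : ContDiff ℝ ∞ φ)
    (hc : HasCompactSupport φ) : pd i (mollify F φ) = mollify F (pd i φ) := by
  funext y
  have h := hc.hasFDerivAt_convolution_right (ContinuousLinearMap.mul ℝ ℝ) hF
    (hφ.of_le (by simp)) y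
  unfold pd mollify
  rw [h.fderiv, convolution_precompR_apply _ hF (hc.fderiv ℝ) (hφ.continuous_fderiv (by simp))]

lemma lap_mollify (hF : LocallyIntegrable F) (hφ : ContDiff ℝ ∞ φ)
    (hc : HasCompactSupport φ) (y : EuclideanSpace ℝ (Fin d)) :
    lap (mollify F φ) y = mollify F (lap φ) y := by
  unfold lap
  have h : ∀ i, pd i (pd i (mollify F φ)) y = mollify F (pd i (pd i φ)) y := fun i => by
    rw [pd_mollify i hF hφ hc, pd_mollify i hF (hφ.pd i) (hc.pd i)]
  simp_rw [h]
  simp only [mollify, convolution_mul, Finset.mul_sum]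
  rw [integral_finsetSum]
  intro i _
  exact ((hc.pd i).pd i).convolutionExists_right (ContinuousLinearMap.mul ℝ ℝ) hF
    ((hφ.pd i).pd i).continuous y

lemma pd_comp_const_sub (i : Fin d) (y : EuclideanSpace ℝ (Fin d)) (hφ : ContDiff ℝ ∞ φ) :
    pd i (fun t => φ (y - t)) = fun t => -pd i φ (y - t) := by
  funext t
  have h := (hφ.differentiable (by simp) (y - t)).hasFDerivAt.comp t
    ((hasFDerivAt_id t).const_sub y)
  have h' : HasFDerivAt (fun t => φ (y - t)) _ t := h
  unfold pd
  rw [h'.fderiv]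
  simp

lemma lap_comp_const_sub (y t : EuclideanSpace ℝ (Fin d)) (hφ : ContDiff ℝ ∞ φ) :
    lap (fun t => φ (y - t)) t = lap φ (y - t) := by
  unfold lap
  refine Finset.sum_congr rfl fun i _ => ?_
  have h : (fun t => -pd i φ (y - t)) = fun t => (-1) * pd i φ (y - t) := by
    funext t
    ring
  rw [pd_comp_const_sub i y hφ, h, pd_const_mul, pd_comp_const_sub i y (hφ.pd i)]
  ring

/-- Mollification turns a distributional Laplacian into a classical one. -/
lemma lap_mollify_of_weak (hF : LocallyIntegrable F) {U : Set (EuclideanSpace ℝ (Fin d))}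
    (hW : ∀ χ : EuclideanSpace ℝ (Fin d) → ℝ, ContDiff ℝ ∞ χ → HasCompactSupport χ →
      tsupport χ ⊆ U → ∫ y, F y * lap χ y = ∫ y, H y * χ y)
    (hφ : ContDiff ℝ ∞ φ) (hc : HasCompactSupport φ) {r : ℝ}
    (hr : tsupport φ ⊆ Metric.closedBall 0 r) {y : EuclideanSpace ℝ (Fin d)}
    (hy : Metric.closedBall y r ⊆ U) : lap (mollify F φ) y = mollify H φ y := by
  rw [lap_mollify hF hφ hc]
  simp only [mollify, convolution_mul]
  have hs : tsupport (fun t => φ (y - t)) = (Homeomorph.subLeft y) ⁻¹' tsupport φ :=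
    tsupport_comp_eq_preimage φ (Homeomorph.subLeft y)
  rw [← hW (fun t => φ (y - t)) (hφ.comp (contDiff_const.sub contDiff_id))
    (hc.comp_homeomorph (Homeomorph.subLeft y))]
  · simp_rw [lap_comp_const_sub y _ hφ]
  · rw [hs]
    intro t ht
    refine hy ?_
    have := hr ht
    simpa [dist_eq_norm, norm_sub_rev] using this

/-- Translations act continuously on `Lp`. -/
lemma tendsto_eLpNorm_translate (hF : MemLp F 2) :
    Tendsto (fun z : EuclideanSpace ℝ (Fin d) => eLpNorm (fun y => F (z + y) - F y) 2 volume)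
      (𝓝 0) (𝓝 0) := by
  have : Fact ((2 : ℝ≥0∞) ≠ ⊤) := ⟨by simp⟩
  let T : EuclideanSpace ℝ (Fin d) → Lp ℝ 2 (volume : Measure (EuclideanSpace ℝ (Fin d))) :=
    fun z => DomAddAct.mk z +ᵥ hF.toLp F
  have hT : Continuous T := (DomAddAct.continuous_mk).vadd continuous_const
  have h0 : T 0 = hF.toLp F := by simp [T]
  have h1 : Tendsto (fun z => edist (T z) (T 0)) (𝓝 0) (𝓝 0) := by
    simpa using (hT.edist (continuous_const (y := T 0))).tendsto 0
  refine h1.congr fun z => ?_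
  rw [h0]
  simp only [T]
  rw [DomAddAct.mk_vadd_toLp, Lp.edist_toLp_toLp]
  rfl

lemma sq_lintegral_mul_le {X : Type*} [MeasurableSpace X] {μ : Measure X} {a b : X → ℝ≥0∞}
    (ha : AEMeasurable a μ) (hb : AEMeasurable b μ) :
    (∫⁻ x, a x * b x ∂μ) ^ 2 ≤ (∫⁻ x, a x ∂μ) * ∫⁻ x, a x * b x ^ 2 ∂μ := by
  have h := ENNReal.lintegral_mul_le_Lp_mul_Lq μ Real.HolderConjugate.two_two
    (ha.pow_const (1 / 2 : ℝ)) ((ha.pow_const (1 / 2 : ℝ)).mul hb)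
  have e1 : ∀ x, a x ^ (1 / 2 : ℝ) * a x ^ (1 / 2 : ℝ) = a x := fun x => by
    rw [← ENNReal.rpow_add_of_nonneg _ _ (by norm_num) (by norm_num)]
    norm_num
  have e2 : ∀ x : ℝ≥0∞, (x ^ (1 / 2 : ℝ)) ^ 2 = x := fun x => by
    rw [← ENNReal.rpow_natCast, ← ENNReal.rpow_mul]
    norm_num
  simp only [Pi.mul_apply, ← mul_assoc, e1, ENNReal.rpow_two, mul_pow, e2] at h
  calc _ ≤ _ := pow_le_pow_left' h 2
    _ = _ := by rw [mul_pow, e2, e2]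

lemma eLpNorm_two_sq {X : Type*} [MeasurableSpace X] {μ : Measure X} (f : X → ℝ) :
    eLpNorm f 2 μ ^ 2 = ∫⁻ x, ‖f x‖ₑ ^ 2 ∂μ := by
  have := eLpNorm_nnreal_pow_eq_lintegral (f := f) (μ := μ) (p := 2) (by norm_num)
  simpa using this

/-- `mollify F φ - F` is an average of differences of translates against the probability density
`φ`. Apply Cauchy–Schwarz for that density, then Tonelli. -/
lemma eLpNorm_mollify_sub_le (hF : MemLp F 2) {ε : ℝ≥0∞}
    (b : ContDiffBump (0 : EuclideanSpace ℝ (Fin d)))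
    (hb : ∀ z, ‖z‖ ≤ b.rOut → eLpNorm (fun y => F (z + y) - F y) 2 volume ≤ ε) :
    eLpNorm (fun y => mollify F (b.normed volume) y - F y) 2 volume ≤ ε := by
  set φ := b.normed (volume : Measure (EuclideanSpace ℝ (Fin d))) with hφ
  have hFl : LocallyIntegrable F := hF.locallyIntegrable (by norm_num)
  have hφc : Continuous φ := b.continuous_normed
  have hφi : Integrable φ := b.integrable_normed
  have hφ1 : ∫⁻ t, ‖φ t‖ₑ = 1 := by
    have h1 := ofReal_integral_norm_eq_lintegral_enorm hφi
    rw [← h1]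
    have h2 : ∀ t, ‖φ t‖ = φ t := fun t => Real.norm_of_nonneg (b.nonneg_normed t)
    simp_rw [h2]
    rw [hφ, b.integral_normed, ENNReal.ofReal_one]
  have hm : AEStronglyMeasurable
      (fun p : EuclideanSpace ℝ (Fin d) × EuclideanSpace ℝ (Fin d) => F (p.1 - p.2) - F p.1)
      (volume.prod volume) :=
    (hF.1.comp_quasiMeasurePreserving
      (quasiMeasurePreserving_sub_of_right_invariant volume volume)).sub hF.1.comp_fst
  have key : ∀ y, ‖mollify F φ y - F y‖ₑ ^ 2 ≤ ∫⁻ t, ‖φ t‖ₑ * ‖F (y - t) - F y‖ₑ ^ 2 := by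
    intro y
    have hex : Integrable fun t => F (y - t) * φ t := by
      have := b.hasCompactSupport_normed.convolutionExists_left
        (ContinuousLinearMap.mul ℝ ℝ) hφc hFl y (μ := volume)
      refine Integrable.congr this (Eventually.of_forall fun t => ?_)
      simp [mul_comm, φ]
    have e : mollify F φ y - F y = ∫ t, φ t * (F (y - t) - F y) := by
      have h1 : F y = ∫ t, F y * φ t := by rw [integral_const_mul, b.integral_normed, mul_one]
      rw [mollify, convolution_mul_swap]
      conv_lhs => rw [h1]
      rw [← integral_sub hex (hφi.const_mul _)]
      exact integral_congr_ae (Eventually.of_forall fun t => by simp only; ring)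
    rw [e]
    have h2 : ‖∫ t, φ t * (F (y - t) - F y)‖ₑ ≤ ∫⁻ t, ‖φ t‖ₑ * ‖F (y - t) - F y‖ₑ := by
      refine (enorm_integral_le_lintegral_enorm _).trans_eq ?_
      simp_rw [enorm_mul]
    have hmy : AEStronglyMeasurable (fun t => F (y - t) - F y) :=
      (hF.1.comp_quasiMeasurePreserving
        (quasiMeasurePreserving_sub_left_of_right_invariant volume y)).sub aestronglyMeasurable_const
    calc _ ≤ (∫⁻ t, ‖φ t‖ₑ * ‖F (y - t) - F y‖ₑ) ^ 2 := pow_le_pow_left' h2 2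
      _ ≤ _ := sq_lintegral_mul_le hφc.enorm.measurable.aemeasurable hmy.enorm
      _ = _ := by rw [hφ1, one_mul]
  have hsq : eLpNorm (fun y => mollify F φ y - F y) 2 volume ^ 2 ≤ ε ^ 2 := by
    rw [eLpNorm_two_sq]
    calc _ ≤ ∫⁻ y, ∫⁻ t, ‖φ t‖ₑ * ‖F (y - t) - F y‖ₑ ^ 2 := lintegral_mono key
      _ = ∫⁻ t, ∫⁻ y, ‖φ t‖ₑ * ‖F (y - t) - F y‖ₑ ^ 2 := by
        refine lintegral_lintegral_swap ?_
        exact (hφc.enorm.measurable.comp measurable_snd).aemeasurable.mul (hm.enorm.pow_const 2)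
      _ ≤ ∫⁻ t, ‖φ t‖ₑ * ε ^ 2 := by
        refine lintegral_mono fun t => ?_
        simp only
        by_cases ht : ‖t‖ ≤ b.rOut
        · rw [lintegral_const_mul' _ _ (by simp)]
          gcongr
          have := hb (-t) (by simpa using ht)
          calc _ = eLpNorm (fun y => F (-t + y) - F y) 2 volume ^ 2 := by
                rw [eLpNorm_two_sq]
                simp_rw [neg_add_eq_sub]
            _ ≤ _ := pow_le_pow_left' this 2
        · have : φ t = 0 := by
            have hs := b.support_normed_eq (μ := volume)
            by_contra h
            have : t ∈ Metric.ball 0 b.rOut := hs ▸ h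
            simp at this
            exact ht this.le
          simp [this]
      _ = ε ^ 2 := by
        rw [lintegral_mul_const _ hφc.enorm.measurable, hφ1, one_mul]
  exact (ENNReal.pow_le_pow_left_iff two_ne_zero).1 hsq

lemma memLp_mollify (hF : MemLp F 2) (b : ContDiffBump (0 : EuclideanSpace ℝ (Fin d))) :
    MemLp (mollify F (b.normed volume)) 2 := by
  have hm : AEStronglyMeasurable (mollify F (b.normed volume)) :=
    (contDiff_mollify (hF.locallyIntegrable (by norm_num)) b.contDiff_normed
      b.hasCompactSupport_normed).continuous.aestronglyMeasurable
  -- The crude bound `ε = 2 ‖F‖`, from translation invariance, already gives membership in `L²`.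
  have hle : eLpNorm (fun y => mollify F (b.normed volume) y - F y) 2 volume
      ≤ eLpNorm F 2 volume + eLpNorm F 2 volume := by
    refine eLpNorm_mollify_sub_le hF b fun z _ => ?_
    have hz : eLpNorm (fun y => F (z + y)) 2 volume = eLpNorm F 2 volume :=
      eLpNorm_comp_measurePreserving hF.1 (measurePreserving_add_left volume z)
    calc _ ≤ eLpNorm (fun y => F (z + y)) 2 volume + eLpNorm F 2 volume :=
          eLpNorm_sub_le (hF.1.comp_measurePreserving (measurePreserving_add_left volume z)) hF.1
            (by norm_num)
      _ = _ := by rw [hz]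
  have h1 : MemLp (fun y => mollify F (b.normed volume) y - F y) 2 :=
    ⟨hm.sub hF.1, hle.trans_lt (ENNReal.add_lt_top.2 ⟨hF.2, hF.2⟩)⟩
  have h2 := h1.add hF
  refine h2.ae_eq (Eventually.of_forall fun y => ?_)
  simp

lemma tendsto_mollify (hF : MemLp F 2) {b : ℕ → ContDiffBump (0 : EuclideanSpace ℝ (Fin d))}
    (hb : Tendsto (fun n => (b n).rOut) atTop (𝓝 0)) :
    Tendsto (fun n => eLpNorm (fun y => mollify F ((b n).normed volume) y - F y) 2 volume)
      atTop (𝓝 0) := by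
  rw [ENNReal.tendsto_nhds_zero]
  intro ε hε
  have h := (ENNReal.tendsto_nhds_zero.1 (tendsto_eLpNorm_translate hF)) ε hε
  obtain ⟨r, hr, hball⟩ := Metric.eventually_nhds_iff.1 h
  filter_upwards [hb.eventually (gt_mem_nhds hr)] with n hn
  exact eLpNorm_mollify_sub_le hF (b n) fun z hz => hball (by simpa using hz.trans_lt hn)

/-- Weighted squares are continuous under convergence in `L²`. -/
lemma tendsto_integral_mul_sq {c : EuclideanSpace ℝ (Fin d) → ℝ} {K : ℝ}
    (hc : AEStronglyMeasurable c) (hK : ∀ y, |c y| ≤ K)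
    {u : ℕ → EuclideanSpace ℝ (Fin d) → ℝ} (hu : ∀ n, MemLp (u n) 2) (hF : MemLp F 2)
    (h : Tendsto (fun n => eLpNorm (fun y => u n y - F y) 2 volume) atTop (𝓝 0)) :
    Tendsto (fun n => ∫ y, c y * u n y ^ 2) atTop (𝓝 (∫ y, c y * F y ^ 2)) := by
  have hint : ∀ {v : EuclideanSpace ℝ (Fin d) → ℝ}, MemLp v 2 →
      Integrable fun y => c y * v y ^ 2 := fun hv =>
    hv.integrable_sq.bdd_mul hc (Eventually.of_forall hK)
  refine tendsto_integral_of_L1 _ (hint hF).1 (Eventually.of_forall fun n => hint (hu n)) ?_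
  -- Factor `u² - F² = (u - F)(u + F)` and use Hölder.
  have hbound : ∀ n, ∫⁻ y, ‖c y * u n y ^ 2 - c y * F y ^ 2‖ₑ
      ≤ ENNReal.ofReal K * (eLpNorm (fun y => u n y - F y) 2 volume
        * (eLpNorm (fun y => u n y - F y) 2 volume + 2 * eLpNorm F 2 volume)) := by
    intro n
    have hd : AEStronglyMeasurable (fun y => u n y - F y) := (hu n).1.sub hF.1
    have hs : AEStronglyMeasurable (fun y => u n y + F y) := (hu n).1.add hF.1
    have h1 : ∫⁻ y, ‖u n y - F y‖ₑ * ‖u n y + F y‖ₑ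
        ≤ eLpNorm (fun y => u n y - F y) 2 volume * eLpNorm (fun y => u n y + F y) 2 volume := by
      have := eLpNorm_smul_le_mul_eLpNorm (p := 2) (q := 2) (r := 1) hs hd
      rw [eLpNorm_one_eq_lintegral_enorm] at this
      simpa [enorm_mul] using this
    have h2 : eLpNorm (fun y => u n y + F y) 2 volume
        ≤ eLpNorm (fun y => u n y - F y) 2 volume + 2 * eLpNorm F 2 volume := by
      have e : (fun y => u n y + F y) = (fun y => u n y - F y) + (F + F) := by
        funext y
        simp only [Pi.add_apply]
        ring
      rw [e, two_mul]
      refine (eLpNorm_add_le hd (hF.1.add hF.1) (by norm_num)).trans ?_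
      gcongr
      exact eLpNorm_add_le hF.1 hF.1 (by norm_num)
    calc _ ≤ ∫⁻ y, ENNReal.ofReal K * (‖u n y - F y‖ₑ * ‖u n y + F y‖ₑ) := by
          refine lintegral_mono fun y => ?_
          have e : c y * u n y ^ 2 - c y * F y ^ 2 = c y * ((u n y - F y) * (u n y + F y)) := by
            ring
          rw [e, enorm_mul, enorm_mul]
          gcongr
          rw [← ofReal_norm]
          exact ENNReal.ofReal_le_ofReal (hK y)
      _ = ENNReal.ofReal K * ∫⁻ y, ‖u n y - F y‖ₑ * ‖u n y + F y‖ₑ :=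
          lintegral_const_mul' _ _ (by simp)
      _ ≤ _ := by gcongr; exact h1.trans (by gcongr)
  refine tendsto_of_tendsto_of_tendsto_of_le_of_le tendsto_const_nhds ?_ (fun _ => zero_le) hbound
  have hF2 : 2 * eLpNorm F 2 volume ≠ ⊤ := ENNReal.mul_ne_top (by simp) hF.2.ne
  have h3 := h.add_const (2 * eLpNorm F 2 volume)
  have h4 := ENNReal.Tendsto.mul h (Or.inr (by simpa using hF2)) h3 (Or.inr (by simp))
  have h5 := ENNReal.Tendsto.const_mul (a := ENNReal.ofReal K) h4 (Or.inr (by simp))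
  simpa using h5

/-- A quadratic inequality for smooth functions and their Laplacians extends to functions with a
distributional Laplacian in `L²`. -/
theorem weak_of_smooth_inequality {S s : ℝ} (hs : s < S) (hF : MemLp F 2) (hH : MemLp H 2)
    (hW : ∀ χ : EuclideanSpace ℝ (Fin d) → ℝ, ContDiff ℝ ∞ χ → HasCompactSupport χ →
      tsupport χ ⊆ Metric.ball 0 S → ∫ y, F y * lap χ y = ∫ y, H y * χ y)
    {c₀ c₁ c₂ : EuclideanSpace ℝ (Fin d) → ℝ}
    (hm₀ : AEStronglyMeasurable c₀) (hm₁ : AEStronglyMeasurable c₁)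
    (hm₂ : AEStronglyMeasurable c₂)
    (hK₀ : ∃ K, ∀ y, |c₀ y| ≤ K) (hK₁ : ∃ K, ∀ y, |c₁ y| ≤ K)
    (hK₂ : ∃ K, ∀ y, |c₂ y| ≤ K)
    (hc₁ : ∀ y, s < ‖y‖ → c₁ y = 0)
    (hu : ∀ u : EuclideanSpace ℝ (Fin d) → ℝ, ContDiff ℝ ∞ u →
      ∫ y, c₀ y * u y ^ 2 ≤ (∫ y, c₁ y * lap u y ^ 2) + ∫ y, c₂ y * u y ^ 2) :
    ∫ y, c₀ y * F y ^ 2 ≤ (∫ y, c₁ y * H y ^ 2) + ∫ y, c₂ y * F y ^ 2 := by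
  obtain ⟨K₀, hK₀⟩ := hK₀
  obtain ⟨K₁, hK₁⟩ := hK₁
  obtain ⟨K₂, hK₂⟩ := hK₂
  -- Mollification radii stay below half the gap `S - s`, so balls around points of norm at most `s`
  -- remain where the weak equation is known. Elsewhere `c₁` vanishes and the Laplacian need not be
  -- identified.
  let b : ℕ → ContDiffBump (0 : EuclideanSpace ℝ (Fin d)) := fun n =>
    ⟨(S - s) / 2 / (n + 1) / 2, (S - s) / 2 / (n + 1),
      by have : 0 < S - s := by linarith
         positivity,
      half_lt_self (by have : 0 < S - s := by linarith
                       positivity)⟩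
  have hb : Tendsto (fun n => (b n).rOut) atTop (𝓝 0) := by
    have := (tendsto_one_div_add_atTop_nhds_zero_nat (𝕜 := ℝ)).const_mul ((S - s) / 2)
    simp only [mul_zero, mul_one_div] at this
    exact this
  have hle : ∀ n, (b n).rOut ≤ (S - s) / 2 := fun n =>
    div_le_self (by linarith) (by linarith [n.cast_nonneg (α := ℝ)])
  have hFl := hF.locallyIntegrable (by norm_num)
  have hsm : ∀ n, ContDiff ℝ ∞ (mollify F ((b n).normed volume)) := fun n =>
    contDiff_mollify hFl (b n).contDiff_normed (b n).hasCompactSupport_normed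
  have key : ∀ n, ∫ y, c₀ y * mollify F ((b n).normed volume) y ^ 2
      ≤ (∫ y, c₁ y * mollify H ((b n).normed volume) y ^ 2)
        + ∫ y, c₂ y * mollify F ((b n).normed volume) y ^ 2 := by
    intro n
    refine (hu _ (hsm n)).trans_eq ?_
    congr 1
    refine integral_congr_ae (Eventually.of_forall fun y => ?_)
    simp only
    by_cases hy : s < ‖y‖
    · simp [hc₁ y hy]
    · rw [lap_mollify_of_weak hFl hW (b n).contDiff_normed (b n).hasCompactSupport_normed
        (b n).tsupport_normed_eq.subset]
      intro t ht
      have h1 : ‖t‖ ≤ ‖y‖ + ‖t - y‖ := norm_le_norm_add_norm_sub' t y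
      have h2 : ‖t - y‖ ≤ (b n).rOut := by simpa [dist_eq_norm] using ht
      have := hle n
      rw [mem_ball_zero_iff]
      linarith
  have hFn := fun n => memLp_mollify hF (b n)
  have hHn := fun n => memLp_mollify hH (b n)
  exact le_of_tendsto_of_tendsto' (tendsto_integral_mul_sq hm₀ hK₀ hFn hF (tendsto_mollify hF hb))
    ((tendsto_integral_mul_sq hm₁ hK₁ hHn hH (tendsto_mollify hH hb)).add
      (tendsto_integral_mul_sq hm₂ hK₂ hFn hF (tendsto_mollify hF hb))) key

end Mollify

/-! ### Weak derivatives and the distributional Laplacian on `G`. -/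

section Weak

open Filter
open scoped Topology

variable {d : ℕ} {G : Set (EuclideanSpace ℝ (Fin d))} {i : Fin d}
  {u u' v v' χ ψ : EuclideanSpace ℝ (Fin d) → ℝ}

lemma integrable_mul_test (hv : LocallyIntegrableOn v G) (hχ : Continuous χ)
    (hc : HasCompactSupport χ) (hs : tsupport χ ⊆ G) : Integrable fun y => v y * χ y := by
  have h1 : IntegrableOn v (tsupport χ) := hv.integrableOn_compact_subset hs hc
  have h2 : IntegrableOn (fun y => v y * χ y) (tsupport χ) :=
    h1.mul_continuousOn hχ.continuousOn hc
  refine (integrableOn_iff_integrable_of_support_subset fun y hy => ?_).1 h2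
  exact subset_tsupport χ fun h => hy (by simp [h])

lemma setIntegral_mul_test (v : EuclideanSpace ℝ (Fin d) → ℝ) (hs : tsupport χ ⊆ G) :
    ∫ y in G, v y * χ y = ∫ y, v y * χ y :=
  setIntegral_eq_integral_of_forall_compl_eq_zero fun y hy => by
    rw [image_eq_zero_of_notMem_tsupport fun h => hy (hs h), mul_zero]

lemma IsWeakPartial.ae_eq (hG : IsOpen G) (h : IsWeakPartial G i u v) (h' : IsWeakPartial G i u v') :
    v =ᵐ[volume.restrict G] v' := by
  have h0 := hG.ae_eq_zero_of_integral_contDiff_smul_eq_zero (h.2.1.sub h'.2.1) fun φ hφ hc hs => by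
    have e := (h.2.2 φ hφ hc hs).symm.trans (h'.2.2 φ hφ hc hs)
    rw [setIntegral_mul_test v hs, setIntegral_mul_test v' hs, neg_inj] at e
    have e1 : ∀ y, φ y • (v - v') y = v y * φ y - v' y * φ y := fun y => by
      simp only [Pi.sub_apply, smul_eq_mul]
      ring
    simp_rw [e1]
    rw [integral_sub (integrable_mul_test h.2.1 hφ.continuous hc hs)
      (integrable_mul_test h'.2.1 hφ.continuous hc hs), e, sub_self]
  rw [EventuallyEq, ae_restrict_iff' hG.measurableSet]
  filter_upwards [h0] with y hy hyG
  exact sub_eq_zero.1 (hy hyG)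

lemma IsWeakPartial.congr (h : IsWeakPartial G i u v)
    (e : u =ᵐ[volume.restrict G] u') : IsWeakPartial G i u' v := by
  refine ⟨h.1.congr e, h.2.1, fun φ hφ hc hs => ?_⟩
  rw [← h.2.2 φ hφ hc hs]
  refine integral_congr_ae ?_
  filter_upwards [e] with y hy
  rw [hy]

lemma isWeakPartial_weakPartial (h : ∃ v, IsWeakPartial G i u v) :
    IsWeakPartial G i u (weakPartial G i u) := by
  rw [weakPartial, dif_pos h]
  exact h.choose_spec

/-- `weakPartial` is an arbitrary choice; almost-everywhere uniqueness identifies it with the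
derivative supplied by the Sobolev condition, so it can be differentiated again. -/
lemma isWeakPartial_of_memSobolevTwo (hG : IsOpen G) (hψ : MemSobolevTwo G 2 ψ) (i : Fin d) :
    IsWeakPartial G i ψ (weakPartial G i ψ) ∧
      IsWeakPartial G i (weakPartial G i ψ) (weakPartial G i (weakPartial G i ψ)) := by
  obtain ⟨v, hv, hv1⟩ := hψ.2 i
  obtain ⟨w, hw, -⟩ := hv1.2 i
  have h1 := isWeakPartial_weakPartial ⟨v, hv⟩
  exact ⟨h1, isWeakPartial_weakPartial ⟨w, hw.congr (hv.ae_eq hG h1)⟩⟩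

lemma aestronglyMeasurable_weakLaplacian (hG : IsOpen G) (hψ : MemSobolevTwo G 2 ψ) :
    AEStronglyMeasurable (weakLaplacian G ψ) (volume.restrict G) := by
  unfold weakLaplacian
  exact Finset.aestronglyMeasurable_fun_sum _ fun i _ =>
    (isWeakPartial_of_memSobolevTwo hG hψ i).2.2.1.aestronglyMeasurable

/-- The weak Laplacian of a function in `W^{2,2}` is its distributional Laplacian. -/
lemma integral_mul_lap_eq (hG : IsOpen G) (hψ : MemSobolevTwo G 2 ψ) (hχ : ContDiff ℝ ∞ χ)
    (hc : HasCompactSupport χ) (hs : tsupport χ ⊆ G) :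
    ∫ y, ψ y * lap χ y = ∫ y, weakLaplacian G ψ y * χ y := by
  have hs' : ∀ {f : EuclideanSpace ℝ (Fin d) → ℝ} (i : Fin d), tsupport f ⊆ G →
      tsupport (pd i f) ⊆ G := fun i hf => (tsupport_fderiv_apply_subset ℝ _).trans hf
  have hw := isWeakPartial_of_memSobolevTwo hG hψ
  simp only [lap, weakLaplacian, Finset.mul_sum, Finset.sum_mul]
  rw [integral_finsetSum _ fun i _ => integrable_mul_test (hw i).1.1 ((hχ.pd i).pd i).continuous
      ((hc.pd i).pd i) (hs' i (hs' i hs)),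
    integral_finsetSum _ fun i _ => integrable_mul_test (hw i).2.2.1 hχ.continuous hc hs]
  refine Finset.sum_congr rfl fun i _ => ?_
  have e1 := (hw i).1.2.2 (pd i χ) (hχ.pd i) (hc.pd i) (hs' i hs)
  have e2 := (hw i).2.2.2 χ hχ hc hs
  change ∫ y in G, ψ y * pd i (pd i χ) y = _ at e1
  change ∫ y in G, weakPartial G i ψ y * pd i χ y = _ at e2
  rw [setIntegral_mul_test _ (hs' i (hs' i hs))] at e1
  rw [setIntegral_mul_test _ hs] at e2
  rw [e1, e2, neg_neg]

end Weak

/-! ### Absorbing the potential in the Carleman estimate. -/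

section Core

open Filter
open scoped Topology

variable {d : ℕ} {F H : EuclideanSpace ℝ (Fin d) → ℝ}

lemma continuous_weight_annulusCutoff {l₁ l₂ : ℝ} (h₁ : 0 < l₁) (h₂ : l₁ ≤ l₂) {A : ℝ → ℝ}
    (hA : ∀ s, 0 < s → ContDiffAt ℝ ∞ A s) :
    Continuous (fun y : EuclideanSpace ℝ (Fin d) => A ‖y‖ * annulusCutoff l₁ l₂ y ^ 2) ∧
      ∃ K, ∀ y : EuclideanSpace ℝ (Fin d), |A ‖y‖ * annulusCutoff l₁ l₂ y ^ 2| ≤ K := by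
  have hη := puncturedTest_annulusCutoff (d := d) h₁ h₂
  have h := (hη.mul hη).mul_left (contDiffAt_radial hA)
  simp_rw [pow_two]
  exact ⟨h.smooth.continuous, h.compact.exists_bound_of_continuous h.smooth.continuous⟩

lemma measurable_errorCoeff (C α ρ l : ℝ) :
    Measurable (errorCoeff C α ρ l : EuclideanSpace ℝ (Fin d) → ℝ) :=
  measurable_const.indicator Metric.isClosed_closedBall.measurableSet

lemma errorCoeff_nonneg {C : ℝ} (hC : 0 ≤ C) (α ρ l : ℝ) (y : EuclideanSpace ℝ (Fin d)) :
    0 ≤ errorCoeff C α ρ l y :=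
  Set.indicator_nonneg (fun _ _ => by
    have := carlemanWeight_pos α ρ l
    positivity) y

lemma abs_errorCoeff_le {C : ℝ} (hC : 0 ≤ C) (α ρ l : ℝ) (y : EuclideanSpace ℝ (Fin d)) :
    |errorCoeff C α ρ l y| ≤ C * carlemanWeight α ρ l / l ^ 2 := by
  have h : 0 ≤ C * carlemanWeight α ρ l / l ^ 2 := by
    have := carlemanWeight_pos α ρ l
    positivity
  rw [abs_of_nonneg (errorCoeff_nonneg hC α ρ l y)]
  exact Set.indicator_apply_le' (fun _ => le_rfl) fun _ => h

lemma integral_errorCoeff_mul (C α ρ l : ℝ) :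
    ∫ y, errorCoeff C α ρ l y * F y ^ 2
      = C * carlemanWeight α ρ l / l ^ 2 * ∫ y in Metric.closedBall 0 (121 / 100 * l), F y ^ 2 := by
  rw [← integral_const_mul, ← integral_indicator Metric.isClosed_closedBall.measurableSet]
  refine integral_congr_ae (Eventually.of_forall fun y => ?_)
  exact (Set.indicator_mul_left _ _ fun y => F y ^ 2).symm

/-- The Carleman estimate applied to a solution of a differential inequality, with the potential
term absorbed. -/
theorem carleman_differential_inequality (d : ℕ) : ∃ C : ℝ, 0 ≤ C ∧
    ∀ (F H : EuclideanSpace ℝ (Fin d) → ℝ) (KV R l α : ℝ), 0 ≤ KV → 0 < R → 0 < l →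
      11 / 10 * l ≤ R → 2 ≤ α → 24 ^ 5 * KV ^ 2 * R ^ 4 ≤ α ^ 3 → MemLp F 2 → MemLp H 2 →
      (∀ᵐ y, |H y| ≤ KV * |F y|) →
      (∀ χ : EuclideanSpace ℝ (Fin d) → ℝ, ContDiff ℝ ∞ χ → HasCompactSupport χ →
        tsupport χ ⊆ Metric.ball 0 (12 * R) → ∫ y, F y * lap χ y = ∫ y, H y * χ y) →
      α ^ 3 * carlemanWeight α (24 * R) (2 * R) / (128 * R ^ 2)
          * ∫ y in {y | R ≤ ‖y‖ ∧ ‖y‖ ≤ 2 * R}, F y ^ 2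
        ≤ (1 + KV ^ 2 * l ^ 4) * (C * carlemanWeight α (24 * R) l / l ^ 2
            * ∫ y in Metric.closedBall 0 (121 / 100 * l), F y ^ 2)
          + (1 + KV ^ 2 * (9 * R) ^ 4) * (C * carlemanWeight α (24 * R) (9 * R) / (9 * R) ^ 2
            * ∫ y in Metric.closedBall 0 (121 / 100 * (9 * R)), F y ^ 2) := by
  obtain ⟨C, hC, hcar⟩ := carleman_estimate_cutoff d
  refine ⟨C, hC, fun F H KV R l α hKV hR hl hlR hα hαV hF hH hFH hW => ?_⟩
  -- The outer cutoff starts at `9R` and ends at `9.9 R`, below `ρ / 2 = 12 R`.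
  set ρ := 24 * R with hρ
  have hρ0 : 0 < ρ := by positivity
  have hl2 : l ≤ 9 * R := by linarith
  have hα1 : 1 ≤ α := by linarith
  have h₃ : 11 / 10 * (9 * R) ≤ ρ / 2 := by rw [hρ]; linarith
  let η : EuclideanSpace ℝ (Fin d) → ℝ := annulusCutoff l (9 * R)
  let e₁ : EuclideanSpace ℝ (Fin d) → ℝ := errorCoeff C α ρ l
  let e₂ : EuclideanSpace ℝ (Fin d) → ℝ := errorCoeff C α ρ (9 * R)
  let p : EuclideanSpace ℝ (Fin d) → ℝ := fun y => carlemanWeight α ρ ‖y‖ * ‖y‖⁻¹ * η y ^ 2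
  let q : EuclideanSpace ℝ (Fin d) → ℝ := fun y => carlemanWeight α ρ ‖y‖ * ‖y‖ ^ 2 * η y ^ 2
  obtain ⟨hpc, Kp, hKp⟩ : Continuous p ∧ ∃ K, ∀ y, |p y| ≤ K :=
    continuous_weight_annulusCutoff hl hl2 (A := fun s => carlemanWeight α ρ s * s⁻¹)
      fun s hs => (contDiffAt_carlemanWeight α ρ s hs).mul (contDiffAt_inv ℝ hs.ne')
  obtain ⟨hqc, Kq, hKq⟩ : Continuous q ∧ ∃ K, ∀ y, |q y| ≤ K :=
    continuous_weight_annulusCutoff hl hl2 (A := fun s => carlemanWeight α ρ s * s ^ 2)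
      fun s hs => (contDiffAt_carlemanWeight α ρ s hs).mul (contDiffAt_id.pow 2)
  have hp0 : ∀ y, 0 ≤ p y := fun y => by
    have := carlemanWeight_pos α ρ ‖y‖
    positivity
  have hq0 : ∀ y, 0 ≤ q y := fun y => by
    have := carlemanWeight_pos α ρ ‖y‖
    positivity
  have he₁ : ∀ y, 0 ≤ e₁ y := errorCoeff_nonneg hC α ρ l
  have he₂ : ∀ y, 0 ≤ e₂ y := errorCoeff_nonneg hC α ρ (9 * R)
  have hm₁ : AEStronglyMeasurable e₁ := (measurable_errorCoeff C α ρ l).aestronglyMeasurable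
  have hm₂ : AEStronglyMeasurable e₂ := (measurable_errorCoeff C α ρ (9 * R)).aestronglyMeasurable
  have hb₁ := abs_errorCoeff_le (d := d) hC α ρ l
  have hb₂ := abs_errorCoeff_le (d := d) hC α ρ (9 * R)
  have hint : ∀ {c v : EuclideanSpace ℝ (Fin d) → ℝ} {K : ℝ}, MemLp v 2 →
      AEStronglyMeasurable c → (∀ y, |c y| ≤ K) → Integrable fun y => c y * v y ^ 2 :=
    fun hv hc hK => hv.integrable_sq.bdd_mul hc (Eventually.of_forall hK)
  have hmc : AEStronglyMeasurable (fun y => 2 * q y + l ^ 4 * e₁ y + (9 * R) ^ 4 * e₂ y) :=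
    ((hqc.aestronglyMeasurable.const_mul 2).add (hm₁.const_mul _)).add (hm₂.const_mul _)
  have hbc : ∀ y, |2 * q y + l ^ 4 * e₁ y + (9 * R) ^ 4 * e₂ y|
      ≤ 2 * Kq + l ^ 4 * (C * carlemanWeight α ρ l / l ^ 2)
        + (9 * R) ^ 4 * (C * carlemanWeight α ρ (9 * R) / (9 * R) ^ 2) := by
    intro y
    have a1 := le_of_abs_le (hKq y)
    have a2 := le_of_abs_le (hb₁ y)
    have a3 := le_of_abs_le (hb₂ y)
    have a4 := hq0 y
    have a5 := he₁ y
    have a6 := he₂ y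
    rw [abs_of_nonneg (by positivity)]
    gcongr
  -- The outer Caccioppoli ball has radius `1.21 * 9R = 10.89 R < 11 R`, leaving room for
  -- mollification inside radius `12 R`.
  have hweak := weak_of_smooth_inequality (s := 11 * R) (S := 12 * R) (by linarith) hF hH hW
    (c₀ := fun y => (α ^ 3 - α) / ρ * p y)
    (c₁ := fun y => 2 * q y + l ^ 4 * e₁ y + (9 * R) ^ 4 * e₂ y)
    (c₂ := fun y => e₁ y + e₂ y)
    (hpc.aestronglyMeasurable.const_mul _) hmc (hm₁.add hm₂)
    ⟨|(α ^ 3 - α) / ρ| * Kp, fun y => by rw [abs_mul]; gcongr; exact hKp y⟩ ⟨_, hbc⟩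
    ⟨_, fun y => (abs_add_le _ _).trans (add_le_add (hb₁ y) (hb₂ y))⟩
    (fun y hy => by
      have n1 : y ∉ Metric.closedBall (0 : EuclideanSpace ℝ (Fin d)) (121 / 100 * l) := by
        simp
        linarith
      have n2 : y ∉ Metric.closedBall (0 : EuclideanSpace ℝ (Fin d)) (121 / 100 * (9 * R)) := by
        simp
        linarith
      have n3 : η y = 0 := annulusCutoff_eq_zero hl hl2 (by linarith)
      simp [q, n3, e₁, e₂, errorCoeff, Set.indicator_of_notMem n1, Set.indicator_of_notMem n2])
    (fun u hu => hcar α ρ l (9 * R) hα1 hρ0 hl hl2 h₃ u hu)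
  have hHF : ∀ᵐ y, H y ^ 2 ≤ KV ^ 2 * F y ^ 2 := by
    filter_upwards [hFH] with y hy
    rw [← sq_abs, ← sq_abs (F y), ← mul_pow]
    exact pow_le_pow_left₀ (abs_nonneg _) hy 2
  have iH := hint hH hmc hbc
  have iF := hint hF hmc hbc
  have ip : Integrable fun y => p y * F y ^ 2 := hint hF hpc.aestronglyMeasurable hKp
  have iq : Integrable fun y => q y * F y ^ 2 := hint hF hqc.aestronglyMeasurable hKq
  have i₁ : Integrable fun y => e₁ y * F y ^ 2 := hint hF hm₁ hb₁
  have i₂ : Integrable fun y => e₂ y * F y ^ 2 := hint hF hm₂ hb₂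
  have hHle : ∫ y, (2 * q y + l ^ 4 * e₁ y + (9 * R) ^ 4 * e₂ y) * H y ^ 2
      ≤ KV ^ 2 * ∫ y, (2 * q y + l ^ 4 * e₁ y + (9 * R) ^ 4 * e₂ y) * F y ^ 2 := by
    rw [← integral_const_mul]
    refine integral_mono_ae iH (iF.const_mul _) ?_
    filter_upwards [hHF] with y hy
    have a4 := hq0 y
    have a5 := he₁ y
    have a6 := he₂ y
    calc _ ≤ (2 * q y + l ^ 4 * e₁ y + (9 * R) ^ 4 * e₂ y) * (KV ^ 2 * F y ^ 2) := by gcongr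
      _ = _ := by ring
  have split : ∫ y, (2 * q y + l ^ 4 * e₁ y + (9 * R) ^ 4 * e₂ y) * F y ^ 2
      = 2 * (∫ y, q y * F y ^ 2) + l ^ 4 * (∫ y, e₁ y * F y ^ 2)
        + (9 * R) ^ 4 * ∫ y, e₂ y * F y ^ 2 := by
    have e : ∀ y, (2 * q y + l ^ 4 * e₁ y + (9 * R) ^ 4 * e₂ y) * F y ^ 2
        = 2 * (q y * F y ^ 2) + (l ^ 4 * (e₁ y * F y ^ 2) + (9 * R) ^ 4 * (e₂ y * F y ^ 2)) :=
      fun y => by ring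
    have a := integral_add (iq.const_mul 2) ((i₁.const_mul (l ^ 4)).add (i₂.const_mul ((9 * R) ^ 4)))
    have b := integral_add (i₁.const_mul (l ^ 4)) (i₂.const_mul ((9 * R) ^ 4))
    simp only [Pi.add_apply] at a
    simp_rw [e]
    rw [a, b, integral_const_mul, integral_const_mul, integral_const_mul]
    ring
  have split' : ∫ y, (e₁ y + e₂ y) * F y ^ 2 = (∫ y, e₁ y * F y ^ 2) + ∫ y, e₂ y * F y ^ 2 := by
    simp_rw [add_mul]
    exact integral_add i₁ i₂
  have split0 : ∫ y, (α ^ 3 - α) / ρ * p y * F y ^ 2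
      = (α ^ 3 - α) / ρ * ∫ y, p y * F y ^ 2 := by
    simp_rw [mul_assoc]
    exact integral_const_mul _ _
  -- Of these three quarters, one quarter absorbs the potential and one half is kept as the lower
  -- bound.
  have hα3 : 3 / 4 * α ^ 3 ≤ α ^ 3 - α := by nlinarith [sq_nonneg (α - 2)]
  -- `q = ‖y‖³ p` and `‖y‖ < 12 R` on the support of the cutoff, so `α³` only has to beat a multiple
  -- of `KV² R⁴`; the factor `24 ^ 5` is more than enough.
  have hqp : KV ^ 2 * (2 * ∫ y, q y * F y ^ 2) ≤ α ^ 3 / (4 * ρ) * ∫ y, p y * F y ^ 2 := by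
    rw [← integral_const_mul, ← integral_const_mul, ← integral_const_mul]
    refine integral_mono ((iq.const_mul 2).const_mul _) (ip.const_mul _) fun y => ?_
    simp only
    by_cases hy : 11 / 10 * (9 * R) ≤ ‖y‖
    · have n3 : η y = 0 := annulusCutoff_eq_zero hl hl2 hy
      simp [p, q, n3]
    rcases eq_or_ne y 0 with rfl | hy0
    · have n3 : η 0 = 0 := (puncturedTest_annulusCutoff hl hl2).apply_zero
      simp [p, q, n3]
    push Not at hy
    have hr : 0 < ‖y‖ := norm_pos_iff.2 hy0
    have hqe : q y = ‖y‖ ^ 3 * p y := by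
      simp only [p, q]
      field_simp
    have h3 : ‖y‖ ^ 3 ≤ (12 * R) ^ 3 := pow_le_pow_left₀ hr.le (by linarith) 3
    have h4 : KV ^ 2 * (2 * (12 * R) ^ 3) ≤ α ^ 3 / (4 * ρ) := by
      rw [le_div_iff₀ (by positivity), hρ]
      have : 0 ≤ KV ^ 2 * R ^ 4 := by positivity
      nlinarith
    have h5 : 0 ≤ p y * F y ^ 2 := mul_nonneg (hp0 y) (sq_nonneg _)
    calc KV ^ 2 * (2 * (q y * F y ^ 2)) = KV ^ 2 * (2 * ‖y‖ ^ 3) * (p y * F y ^ 2) := by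
          rw [hqe]; ring
      _ ≤ KV ^ 2 * (2 * (12 * R) ^ 3) * (p y * F y ^ 2) := by gcongr
      _ ≤ _ := by gcongr
  -- On this annulus the cutoff is 1, and both the weight and `‖y‖⁻¹` are smallest at radius `2R`.
  have hlow : carlemanWeight α ρ (2 * R) / (2 * R)
      * ∫ y in {y | R ≤ ‖y‖ ∧ ‖y‖ ≤ 2 * R}, F y ^ 2 ≤ ∫ y, p y * F y ^ 2 := by
    have hN : MeasurableSet {y : EuclideanSpace ℝ (Fin d) | R ≤ ‖y‖ ∧ ‖y‖ ≤ 2 * R} :=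
      ((isClosed_le continuous_const continuous_norm).inter
        (isClosed_le continuous_norm continuous_const)).measurableSet
    rw [← integral_const_mul, ← integral_indicator hN]
    refine integral_mono ((hF.integrable_sq.const_mul _).indicator hN) ip fun y => ?_
    by_cases hy : R ≤ ‖y‖ ∧ ‖y‖ ≤ 2 * R
    · rw [Set.indicator_of_mem (by exact hy)]
      have n3 : η y = 1 := annulusCutoff_eq_one hl hl2 (by linarith [hy.1]) (by linarith [hy.2])
      have hr : 0 < ‖y‖ := hR.trans_le hy.1
      have hw := carlemanWeight_anti (α := α) (ρ := ρ) (by linarith) hr hy.2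
        (by rw [hρ]; linarith)
      have hw0 := carlemanWeight_pos α ρ ‖y‖
      simp only [p, n3, one_pow, mul_one, div_eq_mul_inv]
      gcongr
      exact hy.2
    · rw [Set.indicator_of_notMem (by exact hy)]
      exact mul_nonneg (hp0 y) (sq_nonneg _)
  rw [split0, split'] at hweak
  rw [split] at hHle
  rw [← integral_errorCoeff_mul, ← integral_errorCoeff_mul]
  change _ ≤ (1 + KV ^ 2 * l ^ 4) * (∫ y, e₁ y * F y ^ 2)
    + (1 + KV ^ 2 * (9 * R) ^ 4) * ∫ y, e₂ y * F y ^ 2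
  have hPn : 0 ≤ ∫ y, p y * F y ^ 2 :=
    integral_nonneg fun y => mul_nonneg (hp0 y) (sq_nonneg _)
  have hfirst : 3 / 4 * α ^ 3 / ρ * ∫ y, p y * F y ^ 2 ≤ (α ^ 3 - α) / ρ * ∫ y, p y * F y ^ 2 := by
    gcongr
  have hα0 : 0 ≤ α ^ 3 / (2 * ρ) := by positivity
  have hlow' := mul_le_mul_of_nonneg_left hlow hα0
  have eL : α ^ 3 / (2 * ρ) * (carlemanWeight α ρ (2 * R) / (2 * R)
      * ∫ y in {y | R ≤ ‖y‖ ∧ ‖y‖ ≤ 2 * R}, F y ^ 2)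
      = 4 / 3 * (α ^ 3 * carlemanWeight α ρ (2 * R) / (128 * R ^ 2)
        * ∫ y in {y | R ≤ ‖y‖ ∧ ‖y‖ ≤ 2 * R}, F y ^ 2) := by
    rw [hρ]
    field_simp
    ring
  have hLn : 0 ≤ α ^ 3 * carlemanWeight α ρ (2 * R) / (128 * R ^ 2)
        * ∫ y in {y | R ≤ ‖y‖ ∧ ‖y‖ ≤ 2 * R}, F y ^ 2 := by
    have := carlemanWeight_pos α ρ (2 * R)
    have : 0 ≤ ∫ y in {y | R ≤ ‖y‖ ∧ ‖y‖ ≤ 2 * R}, F y ^ 2 :=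
      integral_nonneg fun y => sq_nonneg _
    positivity
  have e6 : 3 / 4 * α ^ 3 / ρ * ∫ y, p y * F y ^ 2
      = α ^ 3 / (4 * ρ) * (∫ y, p y * F y ^ 2) + α ^ 3 / (2 * ρ) * ∫ y, p y * F y ^ 2 := by
    field_simp
    ring
  rw [eL] at hlow'
  linarith

end Core

/-! ### Localisation around `x`, comparison of weights, and the explicit constant. -/

section Final

variable {d : ℕ} {G : Set (EuclideanSpace ℝ (Fin d))} {ψ : EuclideanSpace ℝ (Fin d) → ℝ}

lemma pd_comp_sub (i : Fin d) (x : EuclideanSpace ℝ (Fin d)) (f : EuclideanSpace ℝ (Fin d) → ℝ) :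
    pd i (fun z => f (z - x)) = fun z => pd i f (z - x) := by
  funext z
  simp only [pd, fderiv_comp_sub]

lemma lap_comp_sub (x z : EuclideanSpace ℝ (Fin d)) (f : EuclideanSpace ℝ (Fin d) → ℝ) :
    lap (fun z => f (z - x)) z = lap f (z - x) := by
  simp only [lap, pd_comp_sub]

lemma memLp_localize {f : EuclideanSpace ℝ (Fin d) → ℝ} {r : ℝ} {x : EuclideanSpace ℝ (Fin d)}
    (hf : MemLp f 2 (volume.restrict G)) (hr : Metric.ball x r ⊆ G) :
    MemLp (fun y => (Metric.ball x r).indicator f (x + y)) 2 :=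
  ((memLp_indicator_iff_restrict Metric.isOpen_ball.measurableSet).2
    (hf.mono_measure (Measure.restrict_mono hr le_rfl))).comp_measurePreserving
      (measurePreserving_add_left volume x)

lemma setIntegral_localize (ψ : EuclideanSpace ℝ (Fin d) → ℝ) {r : ℝ}
    {x : EuclideanSpace ℝ (Fin d)} {s : Set (EuclideanSpace ℝ (Fin d))} (hs : MeasurableSet s)
    (hsr : s ⊆ Metric.ball x r) :
    ∫ y in (x + ·) ⁻¹' s, (Metric.ball x r).indicator ψ (x + y) ^ 2 = ∫ y in s, ψ y ^ 2 := by
  rw [(measurePreserving_add_left volume x).setIntegral_preimage_emb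
    (MeasurableEquiv.addLeft x).measurableEmbedding
    (fun z => (Metric.ball x r).indicator ψ z ^ 2)]
  exact setIntegral_congr_fun hs fun y hy => by simp only [Set.indicator_of_mem (hsr hy)]

lemma weak_lap_localize (hG : IsOpen G) (hψ : MemSobolevTwo G 2 ψ) {r : ℝ}
    {x : EuclideanSpace ℝ (Fin d)} (hr : Metric.ball x r ⊆ G)
    {χ : EuclideanSpace ℝ (Fin d) → ℝ} (hχ : ContDiff ℝ ∞ χ) (hc : HasCompactSupport χ)
    (hs : tsupport χ ⊆ Metric.ball 0 r) :
    ∫ y, (Metric.ball x r).indicator ψ (x + y) * lap χ y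
      = ∫ y, (Metric.ball x r).indicator (weakLaplacian G ψ) (x + y) * χ y := by
  let χ' : EuclideanSpace ℝ (Fin d) → ℝ := fun z => χ (z - x)
  have hs' : tsupport χ' ⊆ Metric.ball x r := by
    have : tsupport χ' = (Homeomorph.subRight x) ⁻¹' tsupport χ :=
      tsupport_comp_eq_preimage χ (Homeomorph.subRight x)
    rw [this]
    intro z hz
    simpa [dist_eq_norm] using hs hz
  have hz : ∀ z ∉ Metric.ball x r, χ' z = 0 ∧ lap χ' z = 0 := fun z hz => by
    have hz' : z ∉ tsupport χ' := fun h => hz (hs' h)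
    exact ⟨image_eq_zero_of_notMem_tsupport hz', lap_eq_zero_of_eventually_const (c := 0)
      (notMem_tsupport_iff_eventuallyEq.1 hz')⟩
  have e := integral_mul_lap_eq hG hψ (hχ.comp (contDiff_id.sub contDiff_const))
    (hc.comp_homeomorph (Homeomorph.subRight x)) (hs'.trans hr)
  change ∫ z, ψ z * lap χ' z = ∫ z, weakLaplacian G ψ z * χ' z at e
  rw [← integral_add_left_eq_self (fun z => ψ z * lap χ' z) x,
    ← integral_add_left_eq_self (fun z => weakLaplacian G ψ z * χ' z) x] at e
  have hlap : ∀ y, lap χ' (x + y) = lap χ y := fun y => by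
    rw [lap_comp_sub, add_sub_cancel_left]
  have hχe : ∀ y, χ' (x + y) = χ y := fun y => by simp [χ']
  have h1 : ∀ y, (Metric.ball x r).indicator ψ (x + y) * lap χ y = ψ (x + y) * lap χ' (x + y) := by
    intro y
    by_cases hy : x + y ∈ Metric.ball x r
    · rw [Set.indicator_of_mem hy, hlap]
    · rw [← hlap, (hz _ hy).2, mul_zero, mul_zero]
  have h2 : ∀ y, (Metric.ball x r).indicator (weakLaplacian G ψ) (x + y) * χ y
      = weakLaplacian G ψ (x + y) * χ' (x + y) := by
    intro y
    by_cases hy : x + y ∈ Metric.ball x r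
    · rw [Set.indicator_of_mem hy, hχe]
    · rw [← hχe, (hz _ hy).1, mul_zero, mul_zero]
  simp_rw [h1, h2]
  exact e

/-- The distance from `x` to `Θ` need not be attained, so the upper bound uses a point at distance
below `R + ε` and the diameter. -/
lemma subset_annulus {Θ : Set (EuclideanSpace ℝ (Fin d))} {x : EuclideanSpace ℝ (Fin d)} {R : ℝ}
    (hR : 0 < R) (hdiam : Metric.ediam Θ ≤ ENNReal.ofReal R)
    (hdist : Metric.infEDist x Θ = ENNReal.ofReal R) :
    Θ ⊆ {y | R ≤ dist y x ∧ dist y x ≤ 2 * R} := by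
  intro y hy
  constructor
  · have h : ENNReal.ofReal R ≤ edist x y := hdist ▸ Metric.infEDist_le_edist_of_mem hy
    rw [edist_dist, ENNReal.ofReal_le_ofReal_iff dist_nonneg] at h
    rwa [dist_comm]
  · refine le_of_forall_pos_lt_add fun ε hε => ?_
    have h : Metric.infEDist x Θ < ENNReal.ofReal (R + ε) := by
      rw [hdist]
      exact (ENNReal.ofReal_lt_ofReal_iff (by linarith)).2 (by linarith)
    obtain ⟨z, hz, hxz⟩ := Metric.infEDist_lt_iff.1 h
    have h2 : edist y z ≤ ENNReal.ofReal R := (Metric.edist_le_ediam_of_mem hy hz).trans hdiam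
    rw [edist_dist, ENNReal.ofReal_lt_ofReal_iff (by linarith)] at hxz
    rw [edist_dist, ENNReal.ofReal_le_ofReal_iff hR.le] at h2
    have := dist_triangle y z x
    rw [dist_comm z x] at this
    linarith

/-- The gap in the exponents is `2α (log (9/2) - 7/24)`, and `log (9/2) ≥ 1 + 7/24`. The factor `exp
(2α)` thus gained is what pays for `β`. -/
lemma carlemanWeight_outer_le {α R : ℝ} (hα : 0 ≤ α) (hR : 0 < R) :
    carlemanWeight α (24 * R) (9 * R) * Real.exp (2 * α) ≤ carlemanWeight α (24 * R) (2 * R) := by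
  unfold carlemanWeight
  rw [← Real.exp_add]
  refine Real.exp_le_exp.2 ?_
  have hlog : 31 / 24 ≤ Real.log (9 / 2) := by
    rw [Real.le_log_iff_exp_le (by norm_num)]
    have h1 := Real.exp_one_lt_d9
    have h2 : Real.exp (7 / 24) * (17 / 24) ≤ 1 := by
      have h := Real.add_one_le_exp (-(7 / 24 : ℝ))
      rw [Real.exp_neg] at h
      have hp := Real.exp_pos (7 / 24)
      calc _ ≤ Real.exp (7 / 24) * (Real.exp (7 / 24))⁻¹ := by
            gcongr
            linarith
        _ = 1 := mul_inv_cancel₀ hp.ne'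
    have e : Real.exp (31 / 24) = Real.exp 1 * Real.exp (7 / 24) := by
      rw [← Real.exp_add]
      norm_num
    rw [e]
    nlinarith [Real.exp_pos 1, Real.exp_pos (7 / 24)]
  rw [Real.log_div (by norm_num) (by norm_num)] at hlog
  rw [Real.log_mul (by norm_num) hR.ne', Real.log_mul (by norm_num) hR.ne']
  have e1 : 9 * R / (24 * R) = 9 / 24 := by field_simp
  have e2 : 2 * R / (24 * R) = 2 / 24 := by field_simp
  rw [e1, e2]
  nlinarith

/-- After the logarithms of `δ` and `R` cancel, it remains that `δ / (120 R) ≤ 1/30 ≤ 1/12` and `5 *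
2 ≤ 48`. -/
lemma carlemanWeight_inner_le {α R δ : ℝ} (hα : 0 ≤ α) (hR : 0 < R) (hδ : 0 < δ)
    (hδR : δ < 4 * R) :
    carlemanWeight α (24 * R) (δ / 5) * (δ / (48 * R)) ^ (2 * α)
      ≤ carlemanWeight α (24 * R) (2 * R) := by
  unfold carlemanWeight
  rw [Real.rpow_def_of_pos (by positivity), ← Real.exp_add]
  refine Real.exp_le_exp.2 ?_
  rw [Real.log_div hδ.ne' (by norm_num : (5 : ℝ) ≠ 0),
    Real.log_div hδ.ne' (by positivity : 48 * R ≠ 0),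
    Real.log_mul (by norm_num) hR.ne', Real.log_mul (by norm_num) hR.ne']
  have e1 : δ / 5 / (24 * R) ≤ 1 / 30 := by
    rw [div_le_iff₀ (by positivity)]
    linarith
  have e2 : 2 * R / (24 * R) = 2 / 24 := by field_simp
  have e3 : Real.log 5 + Real.log 2 ≤ Real.log 48 := by
    rw [← Real.log_mul (by norm_num) (by norm_num)]
    exact Real.log_le_log (by norm_num) (by norm_num)
  rw [e2]
  nlinarith

/-- The arithmetic that turns the Carleman inequality into the explicit lower bound. -/
lemma explicitBound_of_carleman {C KV R δ α β N₀ N₁ : ℝ} (hC : 0 ≤ C) (hR : 0 < R)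
    (hδ : 0 < δ) (hδ1 : δ ≤ 1) (hδR : δ < 4 * R) (hα : 2 ≤ α)
    (hαV : 24 ^ 5 * KV ^ 2 * R ^ 4 ≤ α ^ 3) (hβ : (1 + 100 * C) * β ≤ Real.exp (2 * α))
    (hβ0 : 0 ≤ β) (hN₀ : 0 ≤ N₀) (hN₁ : 0 ≤ N₁)
    (h : α ^ 3 * carlemanWeight α (24 * R) (2 * R) / (128 * R ^ 2) * N₀
      ≤ (1 + KV ^ 2 * (δ / 5) ^ 4) * (C * carlemanWeight α (24 * R) (δ / 5) / (δ / 5) ^ 2 * N₁)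
        + (1 + KV ^ 2 * (9 * R) ^ 4) * (C * carlemanWeight α (24 * R) (9 * R) / (9 * R) ^ 2
          * (β * N₀))) :
    explicitBound 2 (1 + 100 * C) 1 KV R δ α * N₀ ≤ N₁ := by
  have hα0 : 0 ≤ α := by linarith
  have hA := carlemanWeight_outer_le hα0 hR
  have hB := carlemanWeight_inner_le hα0 hR hδ hδR
  set w₂ := carlemanWeight α (24 * R) (2 * R)
  set w₁ := carlemanWeight α (24 * R) (δ / 5)
  set w₉ := carlemanWeight α (24 * R) (9 * R)
  set P := (δ / (48 * R)) ^ (2 * α) with hP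
  have hP0 : 0 < P := Real.rpow_pos_of_pos (by positivity) _
  have hw₁ : 0 < w₁ := carlemanWeight_pos _ _ _
  have hw₂ : 0 < w₂ := carlemanWeight_pos _ _ _
  have hw₉ : 0 < w₉ := carlemanWeight_pos _ _ _
  have hα8 : 8 ≤ α ^ 3 := by
    calc (8 : ℝ) = 2 ^ 3 := by norm_num
      _ ≤ α ^ 3 := pow_le_pow_left₀ (by norm_num) hα 3
  have h1 : 1 + KV ^ 2 * (9 * R) ^ 4 ≤ 2 * α ^ 3 := by
    have : 0 ≤ KV ^ 2 * R ^ 4 := by positivity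
    nlinarith
  -- The 100 in `1 + 100 * C` makes the outer error at most half of the left side.
  have h2 : C * w₉ * β ≤ w₂ / 100 := by
    have a1 : 100 * C * β ≤ Real.exp (2 * α) := by nlinarith
    nlinarith
  have h3 : (1 + KV ^ 2 * (9 * R) ^ 4) * (C * w₉ / (9 * R) ^ 2 * (β * N₀))
      ≤ α ^ 3 * w₂ / (256 * R ^ 2) * N₀ := by
    calc _ = (1 + KV ^ 2 * (9 * R) ^ 4) * (C * w₉ * β) * (N₀ / (81 * R ^ 2)) := by ring
      _ ≤ (2 * α ^ 3) * (w₂ / 100) * (N₀ / (81 * R ^ 2)) := by gcongr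
      _ = (2 / 8100) * (α ^ 3 * w₂ / R ^ 2 * N₀) := by ring
      _ ≤ (1 / 256) * (α ^ 3 * w₂ / R ^ 2 * N₀) :=
          mul_le_mul_of_nonneg_right (by norm_num) (by positivity)
      _ = _ := by ring
  have h4 : (1 + KV ^ 2 * (δ / 5) ^ 4) * (C * w₁ / (δ / 5) ^ 2 * N₁)
      ≤ (1 + KV ^ 2) * ((1 + 100 * C) / 4) * w₁ / δ ^ 2 * N₁ := by
    have a1 : (δ / 5) ^ 4 ≤ 1 := pow_le_one₀ (by positivity) (by linarith)
    have a2 : KV ^ 2 * (δ / 5) ^ 4 ≤ KV ^ 2 := mul_le_of_le_one_right (sq_nonneg _) a1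
    calc _ = (1 + KV ^ 2 * (δ / 5) ^ 4) * (25 * C) * (w₁ / δ ^ 2 * N₁) := by
          field_simp
          ring
      _ ≤ (1 + KV ^ 2) * ((1 + 100 * C) / 4) * (w₁ / δ ^ 2 * N₁) := by
          gcongr
          linarith
      _ = _ := by ring
  have h5 : α ^ 3 * w₂ / (256 * R ^ 2) * N₀
      ≤ (1 + KV ^ 2) * ((1 + 100 * C) / 4) * w₁ / δ ^ 2 * N₁ := by
    have e : α ^ 3 * w₂ / (128 * R ^ 2) * N₀ = 2 * (α ^ 3 * w₂ / (256 * R ^ 2) * N₀) := by ring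
    linarith
  -- The growing factor `α³` is only used through `α³ ≥ 2³`, the `C₂³` of the explicit bound.
  have h6 : 8 * (w₁ * P) / (256 * R ^ 2) * N₀ ≤ α ^ 3 * w₂ / (256 * R ^ 2) * N₀ := by
    gcongr
  have h7 : P / (32 * R ^ 2) * N₀ ≤ (1 + KV ^ 2) * ((1 + 100 * C) / 4) / δ ^ 2 * N₁ := by
    refine le_of_mul_le_mul_left ?_ hw₁
    calc _ = 8 * (w₁ * P) / (256 * R ^ 2) * N₀ := by ring
      _ ≤ _ := h6.trans h5
      _ = _ := by ring
  have hδ4 : δ ^ 4 ≤ δ ^ 2 := pow_le_pow_of_le_one hδ.le hδ1 (by norm_num)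
  have hK : 0 < (1 + KV ^ 2) * (1 + 100 * C) := by positivity
  have h8 : δ ^ 2 * P / (8 * R ^ 2) / ((1 + KV ^ 2) * (1 + 100 * C)) * N₀ ≤ N₁ := by
    have := mul_le_mul_of_nonneg_left h7
      (by positivity : 0 ≤ 4 * δ ^ 2 / ((1 + KV ^ 2) * (1 + 100 * C)))
    calc _ = 4 * δ ^ 2 / ((1 + KV ^ 2) * (1 + 100 * C)) * (P / (32 * R ^ 2) * N₀) := by
          field_simp
          ring
      _ ≤ _ := this
      _ = N₁ := by field_simp
  refine le_trans ?_ h8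
  gcongr
  unfold explicitBound
  rw [← hP]
  calc _ = (5 / 82) * δ ^ 4 * P / R ^ 2 / ((1 + KV ^ 2) * (1 + 100 * C)) := by
        field_simp
        ring
    _ ≤ (1 / 8) * δ ^ 2 * P / R ^ 2 / ((1 + KV ^ 2) * (1 + 100 * C)) := by
        have : (5 / 82) * δ ^ 4 ≤ (1 / 8) * δ ^ 2 := by nlinarith [pow_pos hδ 2]
        gcongr ?_ * P / R ^ 2 / _
    _ = _ := by
        field_simp

/-- The remaining factors inside the logarithm are at least 1 (`24 R / D ≥ 2`, `min D 1 ≤ 1`) and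
can be dropped. Positivity of `β` is needed because `Real.log 0 = 0` would make the third condition
uninformative. -/
lemma AdmissibleExponent.consequences {C₃ KV D R β α : ℝ} (hC : 1 ≤ C₃) (hD : 0 < D)
    (hDR : D ≤ 12 * R) (hβ : 0 < β) (h : AdmissibleExponent 2 C₃ 1 KV D R β α) :
    2 ≤ α ∧ 24 ^ 5 * KV ^ 2 * R ^ 4 ≤ α ^ 3 ∧ C₃ * β ≤ Real.exp (2 * α) := by
  obtain ⟨h1, h2, h3⟩ := h
  have hα : 0 ≤ α := by linarith
  refine ⟨h1, ?_, ?_⟩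
  · set X := 24 ^ 5 * C₃ * KV ^ 2 * R ^ 4 with hX
    have hX0 : 0 ≤ X := by positivity
    have h4 : X ≤ α ^ 3 := by
      have := pow_le_pow_left₀ (Real.rpow_nonneg hX0 _) h2 3
      rwa [← Real.rpow_natCast, ← Real.rpow_mul hX0, show (1 / 3 : ℝ) * ((3 : ℕ) : ℝ) = 1 by norm_num,
        Real.rpow_one] at this
    refine le_trans ?_ h4
    have : 0 ≤ 24 ^ 5 * KV ^ 2 * R ^ 4 := by positivity
    rw [hX]
    nlinarith
  · have hR : 0 < R := by linarith
    have hm : 0 < min D 1 := lt_min hD one_pos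
    have hm1 : min D 1 ^ 2 ≤ 1 := pow_le_one₀ hm.le (min_le_right _ _)
    have hY : 0 < (24 * R * 1 / D) ^ 4 * C₃ * ((1 + KV ^ 2) / min D 1 ^ 2) * β := by positivity
    rw [Real.log_le_iff_le_exp hY] at h3
    refine le_trans ?_ h3
    have a1 : 1 ≤ (24 * R * 1 / D) ^ 4 :=
      one_le_pow₀ (by rw [le_div_iff₀ hD]; linarith)
    have a2 : 1 ≤ (1 + KV ^ 2) / min D 1 ^ 2 := by
      rw [le_div_iff₀ (by positivity)]
      nlinarith [sq_nonneg KV]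
    calc C₃ * β = 1 * C₃ * 1 * β := by ring
      _ ≤ _ := by gcongr

lemma explicitBound_pos {C₃ KV R δ α : ℝ} (hC : 1 ≤ C₃) (hR : 0 < R) (hδ : 0 < δ) :
    0 < explicitBound 2 C₃ 1 KV R δ α := by
  unfold explicitBound
  have : 0 < (δ / (48 * R)) ^ (2 * α) := Real.rpow_pos_of_pos (by positivity) _
  positivity

lemma explicitBound_anti {C₃ KV R δ α α' : ℝ} (hC : 1 ≤ C₃) (hR : 0 < R) (hδ : 0 < δ)
    (hδR : δ < 4 * R) (h : α ≤ α') :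
    explicitBound 2 C₃ 1 KV R δ α' ≤ explicitBound 2 C₃ 1 KV R δ α := by
  unfold explicitBound
  have h1 : δ / (48 * R) ≤ 1 := by
    rw [div_le_one (by positivity)]
    linarith
  have : (δ / (48 * R)) ^ (2 * α') ≤ (δ / (48 * R)) ^ (2 * α) :=
    Real.rpow_le_rpow_of_exponent_ge (by positivity) h1 (by linarith)
  gcongr

/-- Quantitative unique continuation with the explicit constant, for one admissible exponent. -/
theorem unique_continuation_of_admissible (d : ℕ) : ∃ C₃ : ℝ, 1 ≤ C₃ ∧
    ∀ (KV D R β δ α : ℝ), 0 ≤ KV → 0 < D → D ≤ 12 * R → 0 < δ → δ ≤ 1 → δ < 4 * R →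
      AdmissibleExponent 2 C₃ 1 KV D R β α →
      ∀ (G : Set (EuclideanSpace ℝ (Fin d))) (x : EuclideanSpace ℝ (Fin d))
        (Θ : Set (EuclideanSpace ℝ (Fin d))) (V ψ : EuclideanSpace ℝ (Fin d) → ℝ),
        IsOpen G → Θ ⊆ G → Metric.ediam Θ ≤ ENNReal.ofReal R →
        Metric.infEDist x Θ = ENNReal.ofReal R → Metric.ball x (12 * R) ⊆ G →
        (∀ y ∈ G, |V y| ≤ KV) → MemSobolevTwo G 2 ψ →
        (∀ᵐ y ∂(volume.restrict G), |weakLaplacian G ψ y| ≤ |V y * ψ y|) →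
        sqNorm G ψ / sqNorm Θ ψ ≤ β →
        explicitBound 2 C₃ 1 KV R δ α * sqNorm Θ ψ ≤ sqNorm (Metric.ball x δ) ψ := by
  obtain ⟨C, hC, hcar⟩ := carleman_differential_inequality d
  refine ⟨1 + 100 * C, by linarith, fun KV D R β δ α hKV hD hDR hδ hδ1 hδR hadm G x Θ V ψ hG hΘG
    hdiam hdist hball hV hψ hlap hβ => ?_⟩
  have hR : 0 < R := by linarith
  have hsq : ∀ s : Set (EuclideanSpace ℝ (Fin d)), 0 ≤ sqNorm s ψ := fun s =>
    integral_nonneg fun y => sq_nonneg _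
  -- If `ψ` has no mass on `Θ`, the quotient in the hypothesis is a division by zero with value 0,
  -- but the claim is trivial.
  rcases (hsq Θ).eq_or_lt with h0 | hpos
  · rw [← h0, mul_zero]
    exact hsq _
  have hψ2 : MemLp ψ 2 (volume.restrict G) := hψ.1
  have hψi : IntegrableOn (fun y => ψ y ^ 2) G := hψ2.integrable_sq
  have mono : ∀ {s t : Set (EuclideanSpace ℝ (Fin d))}, s ⊆ t → t ⊆ G →
      ∫ y in s, ψ y ^ 2 ≤ ∫ y in t, ψ y ^ 2 := fun hst htG =>
    setIntegral_mono_set (hψi.mono_set htG)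
      (Filter.Eventually.of_forall fun y => sq_nonneg (ψ y)) hst.eventuallyLE
  rw [div_le_iff₀ hpos] at hβ
  have hΘle : sqNorm Θ ψ ≤ sqNorm G ψ := mono hΘG subset_rfl
  have hβ0 : 0 < β := by
    by_contra hneg
    push Not at hneg
    nlinarith
  obtain ⟨hα, hαV, hexp⟩ := hadm.consequences (by linarith) hD hDR hβ0
  set r := 12 * R with hr
  have hlapV : ∀ᵐ y ∂(volume.restrict G), |weakLaplacian G ψ y| ≤ KV * |ψ y| := by
    filter_upwards [hlap, ae_restrict_mem hG.measurableSet] with y hy hyG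
    refine hy.trans ?_
    rw [abs_mul]
    gcongr
    exact hV y hyG
  -- Square integrability of the Laplacian comes from the differential inequality itself.
  have hL2 : MemLp (weakLaplacian G ψ) 2 (volume.restrict G) := by
    refine (hψ2.const_mul KV).mono (aestronglyMeasurable_weakLaplacian hG hψ) ?_
    filter_upwards [hlapV] with y hy
    simpa [abs_mul, abs_of_nonneg hKV] using hy
  -- Translate `x` to the origin and extend by zero. The jump across the sphere does no harm, since
  -- the equation is only tested inside the ball.
  let F : EuclideanSpace ℝ (Fin d) → ℝ := fun y => (Metric.ball x r).indicator ψ (x + y)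
  let H : EuclideanSpace ℝ (Fin d) → ℝ := fun y =>
    (Metric.ball x r).indicator (weakLaplacian G ψ) (x + y)
  have hFH : ∀ᵐ y, |H y| ≤ KV * |F y| := by
    have h1 : ∀ᵐ z : EuclideanSpace ℝ (Fin d),
        |(Metric.ball x r).indicator (weakLaplacian G ψ) z|
          ≤ KV * |(Metric.ball x r).indicator ψ z| := by
      filter_upwards [(ae_restrict_iff' hG.measurableSet).1 hlapV] with z hz
      by_cases hzb : z ∈ Metric.ball x r
      · simpa only [Set.indicator_of_mem hzb] using hz (hball hzb)
      · simp [Set.indicator_of_notMem hzb]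
    exact (measurePreserving_add_left volume x).quasiMeasurePreserving.ae h1
  -- With `l = δ / 5` the inner ball of radius `1.21 l` lies in `B(x, δ)`, and `δ < 4R` gives `11/10
  -- l ≤ R`.
  have hmain := hcar F H KV R (δ / 5) α hKV hR (by positivity) (by linarith) hα hαV
    (memLp_localize hψ2 hball) (memLp_localize hL2 hball) hFH
    fun χ hχ hc hs => weak_lap_localize hG hψ hball hχ hc hs
  have hcb : ∀ s : ℝ, Metric.closedBall (0 : EuclideanSpace ℝ (Fin d)) s
      = (x + ·) ⁻¹' Metric.closedBall x s := fun s => by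
    ext y
    simp
  have hann : {y : EuclideanSpace ℝ (Fin d) | R ≤ ‖y‖ ∧ ‖y‖ ≤ 2 * R}
      = (x + ·) ⁻¹' {y | R ≤ dist y x ∧ dist y x ≤ 2 * R} := by
    ext y
    simp
  have hannm : MeasurableSet {y : EuclideanSpace ℝ (Fin d) | R ≤ dist y x ∧ dist y x ≤ 2 * R} :=
    ((isClosed_le continuous_const (continuous_id.dist continuous_const)).inter
      (isClosed_le (continuous_id.dist continuous_const) continuous_const)).measurableSet
  have hannb : {y : EuclideanSpace ℝ (Fin d) | R ≤ dist y x ∧ dist y x ≤ 2 * R}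
      ⊆ Metric.ball x r := fun y hy => Metric.mem_ball.2 (by linarith [hy.2])
  have hcbb : ∀ s, s < r → Metric.closedBall x s ⊆ Metric.ball x r := fun s hs =>
    Metric.closedBall_subset_ball hs
  have i1 : 121 / 100 * (δ / 5) < r := by rw [hr]; linarith
  have i2 : 121 / 100 * (9 * R) < r := by rw [hr]; linarith
  rw [hann, hcb, hcb, setIntegral_localize ψ hannm hannb,
    setIntegral_localize ψ Metric.isClosed_closedBall.measurableSet (hcbb _ i1),
    setIntegral_localize ψ Metric.isClosed_closedBall.measurableSet (hcbb _ i2)] at hmain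
  have m0 : sqNorm Θ ψ ≤ ∫ y in {y | R ≤ dist y x ∧ dist y x ≤ 2 * R}, ψ y ^ 2 :=
    mono (subset_annulus hR hdiam hdist) (hannb.trans hball)
  have m1 : ∫ y in Metric.closedBall x (121 / 100 * (δ / 5)), ψ y ^ 2
      ≤ sqNorm (Metric.ball x δ) ψ :=
    mono (Metric.closedBall_subset_ball (by linarith))
      ((Metric.ball_subset_ball (by rw [hr]; linarith)).trans hball)
  have m2 : ∫ y in Metric.closedBall x (121 / 100 * (9 * R)), ψ y ^ 2 ≤ β * sqNorm Θ ψ :=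
    (mono ((hcbb _ i2).trans hball) subset_rfl).trans hβ
  have w := carlemanWeight_pos α (24 * R)
  refine explicitBound_of_carleman hC hR hδ hδ1 hδR hα hαV hexp hβ0.le hpos.le (hsq _) ?_
  calc _ ≤ α ^ 3 * carlemanWeight α (24 * R) (2 * R) / (128 * R ^ 2)
        * ∫ y in {y | R ≤ dist y x ∧ dist y x ≤ 2 * R}, ψ y ^ 2 := by
        have := w (2 * R)
        gcongr
    _ ≤ _ := hmain
    _ ≤ _ := by
        have := w (9 * R)
        have := w (δ / 5)
        gcongr

end Final

theorem theorem3p1 :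
    ∃ KΔ : ℝ, 0 < KΔ ∧ ∀ d : ℕ, ∃ C₂ C₃ : ℝ, 1 ≤ C₂ ∧ 1 ≤ C₃ ∧
      ∀ KV D₀ R β δ : ℝ, 0 ≤ KV → 0 ≤ D₀ → 0 ≤ R → 0 ≤ β → 0 < δ → δ ≤ 1 → δ < 4 * R →
        ∃ C : ℝ, 0 < C ∧
          (0 < D₀ → ∀ α : ℝ, AdmissibleExponent C₂ C₃ KΔ KV (min D₀ (12 * R)) R β α →
            explicitBound C₂ C₃ KΔ KV R δ α ≤ C) ∧
          ∀ (G : Set (EuclideanSpace ℝ (Fin d))) (x : EuclideanSpace ℝ (Fin d))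
            (Θ : Set (EuclideanSpace ℝ (Fin d))) (V ψ : EuclideanSpace ℝ (Fin d) → ℝ),
            IsOpen G → x ∈ G → Θ ⊆ G → NullMeasurableSet Θ volume →
            Metric.ediam Θ ≤ ENNReal.ofReal R →
            Metric.infEDist x Θ = ENNReal.ofReal R →
            Metric.ball x (12 * R + 2 * D₀) ⊆ G →
            AEMeasurable V (volume.restrict G) → (∀ y ∈ G, |V y| ≤ KV) →
            MemSobolevTwo G 2 ψ →
            (∀ᵐ y ∂(volume.restrict G), |weakLaplacian G ψ y| ≤ |V y * ψ y|) →
            sqNorm G ψ / sqNorm Θ ψ ≤ β →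
            C * sqNorm Θ ψ ≤ sqNorm (Metric.ball x δ) ψ := by

  refine ⟨1, one_pos, fun d => ?_⟩
  obtain ⟨C₃, hC₃, huc⟩ := unique_continuation_of_admissible d
  refine ⟨2, C₃, by norm_num, hC₃, fun KV D₀ R β δ hKV hD₀ _ _ hδ hδ1 hδR => ?_⟩
  have hR : 0 < R := by linarith
  -- For `D₀ = 0` any positive `D ≤ 12 R` serves, as the argument only needs the ball of radius `12
  -- R`.
  obtain ⟨D, hD, hDR, hDD₀⟩ : ∃ D, 0 < D ∧ D ≤ 12 * R ∧ (0 < D₀ → D = min D₀ (12 * R)) := by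
    rcases hD₀.eq_or_lt with h | h
    · exact ⟨12 * R, by positivity, le_rfl, fun h' => absurd h' (by simp [← h])⟩
    · exact ⟨min D₀ (12 * R), lt_min h (by positivity), min_le_right _ _, fun _ => rfl⟩
  -- The least admissible exponent. The explicit bound decreases in `α`, so its value at `α₀`
  -- dominates all the others.
  let α₀ : ℝ := max 2 (max ((24 ^ 5 * C₃ * KV ^ 2 * R ^ 4) ^ (1 / 3 : ℝ))
    (Real.log ((24 * R * 1 / D) ^ 4 * C₃ * ((1 + KV ^ 2) / min D 1 ^ 2) * β) / 2))
  have hα₀ : AdmissibleExponent 2 C₃ 1 KV D R β α₀ := by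
    refine ⟨le_max_left _ _, (le_max_left _ _).trans (le_max_right _ _), ?_⟩
    have := (le_max_right ((24 ^ 5 * C₃ * KV ^ 2 * R ^ 4) ^ (1 / 3 : ℝ))
      (Real.log ((24 * R * 1 / D) ^ 4 * C₃ * ((1 + KV ^ 2) / min D 1 ^ 2) * β) / 2)).trans
      (le_max_right 2 _)
    change _ ≤ α₀ at this
    linarith
  refine ⟨explicitBound 2 C₃ 1 KV R δ α₀, explicitBound_pos hC₃ hR hδ, fun hD₀' α hα => ?_,
    fun G x Θ V ψ hG _ hΘG _ hdiam hdist hball _ hV hψ hlap hβ => ?_⟩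
  · rw [← hDD₀ hD₀'] at hα
    refine explicitBound_anti hC₃ hR hδ hδR (max_le hα.1 (max_le hα.2.1 ?_))
    linarith [hα.2.2]
  · exact huc KV D R β δ α₀ hKV hD hDR hδ hδ1 hδR hα₀ G x Θ V ψ hG hΘG hdiam hdist
      ((Metric.ball_subset_ball (by linarith)).trans hball) hV hψ hlap hβ
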